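/- **Theorem (Inverse Clifford $Cl_n$ wavelet transform).** Let $n\equiv 2$ or $3 \pmod 4$. Let $Cl_n=Cl_{n,0}$ be the real Clifford algebra of Euclidean space $\mathbb{R}^n$, with basis blades $e_A=e_{i_1}\cdots e_{i_k}$ ($A=\{i_1<\dots<i_k\}\subseteq\{1,\dots,n\}$), modulus $|\sum_A M_Ae_A|^2=\sum_A M_A^2$, reversion $M\mapsto\widetilde M$ and unit pseudoscalar $i_n=e_1e_2\cdots e_n$ (so $i_n^2=-1$). Write $(f,g)=\int_{\mathbb{R}^n} f(x)\,\widetilde{g(x)}\,d^nx\in Cl_n$ for $f,g\in L^2(\mathbb{R}^n;Cl_n)$, and let $\widehat f(\omega)=\int_{\mathbb{R}^n} f(x)\,e^{-i_n\,\omega\cdot x}\,d^nx$ be the Clifford Fourier transform, extended to $L^2(\mathbb{R}^n;Cl_n)$ as the $L^2$-limit of the integrals over the balls $|x|<R$ as $R\to\infty$. Let $d\theta$ be a Haar measure on $SO(n)$ (with any normalization), $d\mu(a,\theta)=a^{-(n+1)}\,da\,d\theta$ on $\mathbb{R}^+\times SO(n)$, and $d\lambda=d\mu(a,\theta)\,d^nb$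 on $SIM(n)=(\mathbb{R}^+\times SO(n))\rtimes\mathbb{R}^n$. For $\psi\in L^2(\mathbb{R}^n;Cl_n)$ put $$\psi_{a,\theta,b}(x)=a^{-n/2}\,\psi\big(r_\theta^{-1}(\tfrac{x-b}{a})\big),\qquad T_\psi f(a,\theta,b)=(f,\psi_{a,\theta,b})=\int_{\mathbb{R}^n} f(x)\,\widetilde{\psi_{a,\theta,b}(x)}\,d^nx .$$ Assume that $\psi$ is admissible, i.e. for almost every $\omega\in\mathbb{R}^n$ the integral $$C_\psi=\int_{\mathbb{R}^+}\int_{SO(n)}a^n\,\{\widehat\psi(a\,r_\theta^{-1}\omega)\}^{\sim}\,\widehat\psi(a\,r_\theta^{-1}\omega)\,d\mu(a,\theta)$$ converges absolutely and equals one and the same invertible element $C_\psi$ of $Cl_n$; if $n\equiv2\pmod 4$, assume moreover that $\psi$ takes its values (almost everywhere) in the even part $Cl_n^+$, or that it takes them in the odd part $Cl_n^-$. Then every $f\in L^2(\mathbb{R}^n;Cl_n)$ satisfies $$f=\int_{SIM(n)}T_\psi f(a,\theta,b)\,\psi_{a,\theta,b}\,C_\psi^{-1}\,d\mu\,d^nb=\int_{SIM(n)}(f,\psi_{a,\theta,b})\,\psi_{a,\theta,b}\,C_\psi^{-1}\,d\mu\,d^nb,$$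 the integrals converging in the weak sense: for every $g\in L^2(\mathbb{R}^n;Cl_n)$ the function $(a,\theta,b)\mapsto\big(T_\psi f(a,\theta,b)\,\psi_{a,\theta,b}\,C_\psi^{-1},\,g\big)$ is $\lambda$-integrable and its integral is $(f,g)$. -/

import Mathlib

open MeasureTheory Filter Topology

noncomputable section

namespace CliffordWavelet

/-- Euclidean space `ℝⁿ`. -/
abbrev E (n : ℕ) : Type := EuclideanSpace ℝ (Fin n)

/-- The quadratic form `x ↦ x · x` on `ℝⁿ`. -/
def quadForm (n : ℕ) : QuadraticForm ℝ (E n) := LinearMap.BilinMap.toQuadraticMap (innerₗ (E n))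

/-- The real Clifford algebra `Cl_n = Cl_{n,0}`. -/
abbrev Cl (n : ℕ) : Type := CliffordAlgebra (quadForm n)

/-- The standard orthonormal basis vector `e_i` of `ℝⁿ`, as an element of `Cl_n`. -/
def stdVec {n : ℕ} (i : Fin n) : Cl n :=
  CliffordAlgebra.ι (quadForm n) (EuclideanSpace.basisFun (Fin n) ℝ i)

/-- The basis blade `e_A = e_{i₁} ⋯ e_{i_k}`, for `A = {i₁ < ⋯ < i_k}`. -/
def blade {n : ℕ} (A : Finset (Fin n)) : Cl n := ((A.sort (· ≤ ·)).map stdVec).prod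

/-- The blades `e_A` form a basis of `Cl_n`: they correspond to the standard basis of the exterior
algebra (see `bladeBasis_apply`). -/
def bladeBasis (n : ℕ) : Module.Basis (Finset (Fin n)) ℝ (Cl n) :=
  (EuclideanSpace.basisFun (Fin n) ℝ).toBasis.ExteriorAlgebra.map
    (CliffordAlgebra.equivExterior (quadForm n)).symm

theorem contractLeft_prod_eq_zero {n : ℕ} (i : Fin n) (l : List (Fin n)) (hl : i ∉ l)
    (d : Module.Dual ℝ (E n)) (hd : ∀ j, j ≠ i → d (EuclideanSpace.basisFun (Fin n) ℝ j) = 0) :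
    CliffordAlgebra.contractLeft d ((l.map fun j =>
      CliffordAlgebra.ι (0 : QuadraticForm ℝ (E n)) (EuclideanSpace.basisFun (Fin n) ℝ j)).prod)
      = 0 := by
  induction l with
  | nil => simp
  | cons j l ih =>
    have hj : j ≠ i := fun h => hl (by simp [h])
    have hl' : i ∉ l := fun h => hl (by simp [h])
    rw [List.map_cons, List.prod_cons, CliffordAlgebra.contractLeft_ι_mul, ih hl', hd j hj]
    simp

theorem equivExterior_prod {n : ℕ} (l : List (Fin n)) (hl : l.Nodup) :
    CliffordAlgebra.equivExterior (quadForm n) ((l.map stdVec).prod) =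
      (l.map fun j => ExteriorAlgebra.ι ℝ (EuclideanSpace.basisFun (Fin n) ℝ j)).prod := by
  induction l with
  | nil =>
    exact CliffordAlgebra.changeForm_one (CliffordAlgebra.changeForm.associated_neg_proof)
  | cons j l ih =>
    have h := List.nodup_cons.1 hl
    have ih := ih h.2
    rw [List.map_cons, List.prod_cons, List.map_cons, List.prod_cons]
    refine (CliffordAlgebra.changeForm_ι_mul
      (CliffordAlgebra.changeForm.associated_neg_proof (Q := quadForm n)) _ _).trans ?_
    have ih' : CliffordAlgebra.changeForm
        (CliffordAlgebra.changeForm.associated_neg_proof (Q := quadForm n)) ((l.map stdVec).prod) =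
        (l.map fun j =>
          CliffordAlgebra.ι (0 : QuadraticForm ℝ (E n)) (EuclideanSpace.basisFun (Fin n) ℝ j)).prod :=
      ih
    rw [ih', contractLeft_prod_eq_zero j l h.1, sub_zero]
    intro k hk
    simp [quadForm, QuadraticMap.associated_apply, inner_add_right,
      EuclideanSpace.inner_single_left, hk, hk.symm]

theorem bladeBasis_apply {n : ℕ} (A : Finset (Fin n)) : bladeBasis n A = blade A := by
  rw [bladeBasis, Module.Basis.map_apply, LinearEquiv.symm_apply_eq, blade,
    equivExterior_prod _ (Finset.sort_nodup _ _),
    ExteriorAlgebra.basis_apply_ofCard _ (rfl : A.card = A.card), ExteriorAlgebra.ιMulti_family,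
    ExteriorAlgebra.ιMulti_apply, ← Finset.listMap_orderEmbOfFin_finRange A rfl, List.ofFn_eq_map,
    List.map_map]
  rfl

/-- The coordinates `(M_A)_A` of a multivector `M = ∑_A M_A e_A`. -/
def coords (n : ℕ) : Cl n ≃ₗ[ℝ] EuclideanSpace ℝ (Finset (Fin n)) :=
  (bladeBasis n).equivFun.trans (WithLp.linearEquiv 2 ℝ (Finset (Fin n) → ℝ)).symm

/-- `Cl_n` is normed by the modulus `|M| = (∑_A M_A²)^{1/2}`. -/
instance instNormedAddCommGroupCl (n : ℕ) : NormedAddCommGroup (Cl n) :=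
  NormedAddCommGroup.induced (Cl n) (EuclideanSpace ℝ (Finset (Fin n))) (coords n)
    (coords n).injective

instance instNormedSpaceCl (n : ℕ) : NormedSpace ℝ (Cl n) :=
  NormedSpace.induced ℝ (Cl n) (EuclideanSpace ℝ (Finset (Fin n))) (coords n)

instance instFiniteDimensionalCl (n : ℕ) : FiniteDimensional ℝ (Cl n) :=
  Module.Basis.finiteDimensional_of_finite (bladeBasis n)

instance instIsTopologicalRingCl (n : ℕ) : IsTopologicalRing (Cl n) where
  continuous_mul := by
    have h : Continuous fun p : Cl n × Cl n =>
        ((LinearMap.toContinuousLinearMap : (Cl n →ₗ[ℝ] Cl n) ≃ₗ[ℝ] (Cl n →L[ℝ] Cl n)).toLinearMap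
          ∘ₗ LinearMap.mul ℝ (Cl n)) p.1 p.2 :=
      ((LinearMap.continuous_of_finiteDimensional _).comp continuous_fst).clm_apply continuous_snd
    exact h

/-- The unit pseudoscalar `i_n = e_1 e_2 ⋯ e_n`. -/
def pseudoscalar (n : ℕ) : Cl n := blade Finset.univ

/-- The reverse `M ↦ M̃`. -/
def rev {n : ℕ} (M : Cl n) : Cl n := CliffordAlgebra.reverse M

/-- The `Cl_n`-valued inner product `(f, g) = ∫ f(x) g(x)~ dⁿx`. -/
def cliffInner {n : ℕ} (f g : E n → Cl n) : Cl n := ∫ x, f x * rev (g x)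

/-- `F` is the Clifford Fourier transform of `f ∈ L²(ℝⁿ; Cl_n)`: it is the limit in `L²`, for
`R → ∞`, of the integrals `∫_{|x| < R} f(x) e^{-i_n ω·x} dⁿx`. (For `f ∈ L¹ ∩ L²` this is the
integral over `ℝⁿ`, for almost every `ω`.) -/
structure IsCFT {n : ℕ} (f F : E n → Cl n) : Prop where
  memLp : MemLp F 2 volume
  tendsto : Tendsto (fun R : ℝ => eLpNorm (fun ω => F ω -
      ∫ x in Metric.ball (0 : E n) R, f x * NormedSpace.exp (-(inner ℝ ω x) • pseudoscalar n))
      2 volume) atTop (𝓝 0)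

/-- The rotation group `SO(n)`. -/
abbrev SO (n : ℕ) : Type := Matrix.specialOrthogonalGroup (Fin n) ℝ

instance instMeasurableSpaceSO (n : ℕ) : MeasurableSpace (SO n) := borel _

instance instBorelSpaceSO (n : ℕ) : BorelSpace (SO n) := ⟨rfl⟩

/-- The action of a rotation on a vector. -/
def rot {n : ℕ} (r : SO n) (x : E n) : E n := Matrix.toEuclideanLin (r : Matrix _ _ ℝ) x

/-- The measure `dμ(a, θ) = da dθ / a^{n+1}` on `ℝ⁺ × SO(n)`, where `dθ` is `ν`. It is written as a
measure on `ℝ × SO(n)` that vanishes outside `a > 0`. -/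
def dilRotMeasure (n : ℕ) (ν : Measure (SO n)) : Measure (ℝ × SO n) :=
  ((volume.restrict (Set.Ioi (0 : ℝ))).withDensity
    fun a => ENNReal.ofReal (1 / a ^ (n + 1))).prod ν

/-- The measure `dλ = dμ(a, θ) dⁿb` on `SIM(n)`, whose elements are written `((a, r), b)`. -/
def simMeasure (n : ℕ) (ν : Measure (SO n)) : Measure ((ℝ × SO n) × E n) :=
  (dilRotMeasure n ν).prod volume

/-- The daughter wavelet `ψ_{a,θ,b}(x) = a^{-n/2} ψ(r_θ⁻¹((x - b) / a))`. -/
def daughter {n : ℕ} (ψ : E n → Cl n) (p : (ℝ × SO n) × E n) (x : E n) : Cl n :=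
  (1 / p.1.1 ^ ((n : ℝ) / 2)) • ψ (rot p.1.2⁻¹ ((1 / p.1.1) • (x - p.2)))

/-- The Clifford wavelet transform `T_ψ f(a,θ,b) = ∫ f(x) ψ_{a,θ,b}(x)~ dⁿx`. -/
def waveletTransform {n : ℕ} (ψ f : E n → Cl n) (p : (ℝ × SO n) × E n) : Cl n :=
  ∫ x, f x * rev (daughter ψ p x)

/-- The integrand `aⁿ {F(a r_θ⁻¹ ω)}~ F(a r_θ⁻¹ ω)` of the admissibility constant. -/
def admissibilityIntegrand {n : ℕ} (F : E n → Cl n) (ω : E n) (q : ℝ × SO n) : Cl n :=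
  q.1 ^ n • (rev (F (q.1 • rot q.2⁻¹ ω)) * F (q.1 • rot q.2⁻¹ ω))

/-- `ψ ∈ L²(ℝⁿ; Cl_n)` is an admissible mother wavelet with admissibility constant `C_ψ = C`: with
`ψ̂` its Clifford Fourier transform, the integral
`∫_{ℝ⁺} ∫_{SO(n)} aⁿ {ψ̂(a r_θ⁻¹ ω)}~ ψ̂(a r_θ⁻¹ ω) dμ(a, θ)`
converges and equals the invertible constant `C` for almost every `ω`. -/
structure IsAdmissible {n : ℕ} (ν : Measure (SO n)) (ψ : E n → Cl n) (C : Cl n) : Prop where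
  memLp : MemLp ψ 2 volume
  isUnit : IsUnit C
  constant : ∃ F : E n → Cl n, IsCFT ψ F ∧
    ∀ᵐ ω : E n, Integrable (admissibilityIntegrand F ω) (dilRotMeasure n ν) ∧
      ∫ q, admissibilityIntegrand F ω q ∂(dilRotMeasure n ν) = C

/-- The grade restriction on mother wavelets: for `n ≡ 2 (mod 4)`, `ψ` takes its values either in the
even part `Cl_n⁺` or in the odd part `Cl_n⁻`. There is none for `n ≡ 3 (mod 4)`. -/
def GradeRestricted {n : ℕ} (ψ : E n → Cl n) : Prop :=
  n % 4 = 2 → (∀ᵐ x : E n, ψ x ∈ CliffordAlgebra.evenOdd (quadForm n) 0) ∨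
    (∀ᵐ x : E n, ψ x ∈ CliffordAlgebra.evenOdd (quadForm n) 1)

/-- `f = ∫ Φ_p dm(p)` in the weak sense in `L²(ℝⁿ; Cl_n)`: `(f, g) = ∫ (Φ_p, g) dm(p)`, with an
absolutely convergent integral, for every `g ∈ L²(ℝⁿ; Cl_n)`. -/
def IsWeakIntegral {n : ℕ} {X : Type*} [MeasurableSpace X] (m : Measure X) (Φ : X → E n → Cl n)
    (f : E n → Cl n) : Prop :=
  (∀ᵐ p ∂m, MemLp (Φ p) 2 volume) ∧
    ∀ g : E n → Cl n, MemLp g 2 volume →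
      Integrable (fun p => cliffInner (Φ p) g) m ∧ ∫ p, cliffInner (Φ p) g ∂m = cliffInner f g

end CliffordWavelet

end

open CliffordWavelet

open MeasureTheory Filter Topology

noncomputable section

namespace CliffordWavelet

/-! ### Algebra of blades -/

/-! For these `n` the pseudoscalar squares to `-1` and is reversed to its negative, so right
multiplication by `i_n` makes `Cl_n` a complex vector space on which `e^{i_n t}` acts isometrically.
The Clifford Fourier transform is then an ordinary vector-valued Fourier transform with rescaled
frequency, and Plancherel holds with constant `(2π)^{n/2}` (`memLp_cftInt`, `IsCFT.eLpNorm_eq`).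
Left multiplications commute with the kernel, so polarization against the functions `e_A g` gives a
`Cl_n`-valued Parseval identity (`IsCFT.integral_mul_rev`).

The transform of `ψ_{a,θ,b}` is `a^{n/2} ψ̂(a r⁻¹ω) e^{-i_n ω·b}`. By Parseval, `T_ψ f(a,θ,b)` is
`(2π)^{-n}` times the integral of `a^{n/2} f̂(ω) e^{i_n ω·b} ψ̂(a r⁻¹ω)~`. To read this as a
Clifford Fourier integral in `b`, the exponential must pass to the right of `ψ̂~`. This is possible
because `i_n ψ̂ = ε ψ̂ i_n` with one sign `ε`: `i_n` is central for odd `n`, and for even `n` the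
grade restriction supplies the sign (`waveletTransform_eq_cftInt`).

Parseval in `b` followed by Fubini in `(a,θ)` and `ω` collects the admissibility integral between
`f̂` and `ĥ~`, so that `∫ T_ψ f (T_ψ h)~ dλ = (2π)^{-n} ∫ f̂ C_ψ ĥ~`
(`integral_simMeasure_waveletTransform`). Absolute convergence comes from the scalar part of `C_ψ`,
which is the integral of `aⁿ |ψ̂(a r⁻¹ω)|²` (`memLp_freqTransform`). Finally take `h = g (C_ψ⁻¹)~`.
Since `C_ψ` commutes with `i_n`, `ĥ = ĝ (C_ψ⁻¹)~`; the constant cancels, and Parseval returns `(f,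
g)`. -/

theorem stdVec_mul_self {n : ℕ} (i : Fin n) : stdVec i * stdVec i = (1 : Cl n) := by
  have h : quadForm n (EuclideanSpace.basisFun (Fin n) ℝ i) = 1 := by simp [quadForm]
  rw [stdVec, CliffordAlgebra.ι_sq_scalar, h, map_one]

theorem stdVec_mul_anticomm {n : ℕ} {i j : Fin n} (h : i ≠ j) :
    stdVec i * stdVec j = -((stdVec j * stdVec i : Cl n)) := by
  have h' : QuadraticMap.polar (quadForm n) (EuclideanSpace.basisFun (Fin n) ℝ i)
      (EuclideanSpace.basisFun (Fin n) ℝ j) = 0 := by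
    simp [quadForm, QuadraticMap.polar, inner_add_right, EuclideanSpace.inner_single_left, h,
      h.symm]
  rw [eq_neg_iff_add_eq_zero, stdVec, stdVec, CliffordAlgebra.ι_mul_ι_add_swap, h', map_zero]

/-- The sign of the permutation is not tracked: orthonormality of the blades only needs products up
to sign. -/
theorem prod_stdVec_eq_or_neg_of_perm {n : ℕ} {l l' : List (Fin n)} (h : l.Perm l')
    (hl : l.Nodup) :
    ((l.map stdVec).prod : Cl n) = (l'.map stdVec).prod ∨
      ((l.map stdVec).prod : Cl n) = -(l'.map stdVec).prod := by
  induction h with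
  | nil => simp
  | cons x h ih =>
    rcases ih (List.nodup_cons.1 hl).2 with h | h <;> simp [h]
  | swap x y l =>
    right
    have hxy : y ≠ x := fun h => by simp [h] at hl
    simp [← mul_assoc, stdVec_mul_anticomm hxy]
  | trans h₁ h₂ ih₁ ih₂ =>
    rcases ih₁ hl with h | h <;> rcases ih₂ (h₁.nodup_iff.1 hl) with h' | h' <;> simp [h, h']

theorem prod_stdVec_eq_or_neg_blade {n : ℕ} {l : List (Fin n)} (hl : l.Nodup) :
    ((l.map stdVec).prod : Cl n) = blade l.toFinset ∨
      ((l.map stdVec).prod : Cl n) = -blade l.toFinset :=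
  prod_stdVec_eq_or_neg_of_perm
    ((List.perm_ext_iff_of_nodup hl (Finset.sort_nodup _ _)).2 (by simp)) hl

theorem stdVec_mul_blade {n : ℕ} (i : Fin n) (A : Finset (Fin n)) :
    stdVec i * blade A = blade (symmDiff {i} A) ∨
      stdVec i * blade A = -blade (symmDiff {i} A) := by
  by_cases h : i ∈ A
  · have hs : symmDiff {i} A = A.erase i := by
      ext j; simp only [Finset.mem_symmDiff, Finset.mem_singleton, Finset.mem_erase]
      by_cases hj : j = i <;> simp [hj, h]
    -- Up to sign `e_A` is `e_i` times the blade of `A` without `i`, and a second factor `e_i`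
    -- cancels the first.
    have hp : (i :: (A.erase i).sort (· ≤ ·)).Nodup := by simp
    have hA : (i :: (A.erase i).sort (· ≤ ·)).toFinset = A := by simp [Finset.insert_erase h]
    have := prod_stdVec_eq_or_neg_blade hp
    rw [hA, List.map_cons, List.prod_cons, ← blade] at this
    rw [hs]
    rcases this with h' | h'
    · left; rw [← h', ← mul_assoc, stdVec_mul_self, one_mul]
    · right; rw [← neg_neg (blade A), ← h', mul_neg, ← mul_assoc, stdVec_mul_self, one_mul]
  · have hs : symmDiff {i} A = insert i A := by
      ext j; simp only [Finset.mem_symmDiff, Finset.mem_singleton, Finset.mem_insert]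
      by_cases hj : j = i <;> simp [hj, h]
    have hp : (i :: A.sort (· ≤ ·)).Nodup := by simp [h]
    have := prod_stdVec_eq_or_neg_blade hp
    rw [List.map_cons, List.prod_cons, ← blade] at this
    rw [hs]
    simpa using this

theorem prod_stdVec_mul_blade {n : ℕ} (l : List (Fin n)) (hl : l.Nodup) (B : Finset (Fin n)) :
    ((l.map stdVec).prod * blade B : Cl n) = blade (symmDiff l.toFinset B) ∨
      ((l.map stdVec).prod * blade B : Cl n) = -blade (symmDiff l.toFinset B) := by
  induction l with
  | nil => left; simp [symmDiff]
  | cons i l ih =>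
    have hi := List.nodup_cons.1 hl
    have hs : symmDiff (i :: l).toFinset B = symmDiff {i} (symmDiff l.toFinset B) := by
      rw [← symmDiff_assoc]
      congr 1
      ext j; simp only [Finset.mem_symmDiff, Finset.mem_singleton, List.mem_toFinset, List.mem_cons]
      by_cases hj : j = i <;> simp [hj, hi.1]
    rw [List.map_cons, List.prod_cons, mul_assoc, hs]
    rcases ih hi.2 with h | h <;>
      rcases stdVec_mul_blade i (symmDiff l.toFinset B) with h' | h' <;> simp [h, h']

theorem blade_mul_blade {n : ℕ} (A B : Finset (Fin n)) :
    (blade A * blade B : Cl n) = blade (symmDiff A B) ∨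
      (blade A * blade B : Cl n) = -blade (symmDiff A B) := by
  have := prod_stdVec_mul_blade (A.sort (· ≤ ·)) (Finset.sort_nodup _ _) B
  rw [← blade] at this
  simpa using this

theorem rev_prod_stdVec {n : ℕ} (l : List (Fin n)) :
    rev ((l.map stdVec).prod : Cl n) = (l.reverse.map stdVec).prod := by
  induction l with
  | nil => simp [rev]
  | cons i l ih =>
    rw [rev] at ih ⊢
    rw [List.map_cons, List.prod_cons, CliffordAlgebra.reverse.map_mul, ih]
    simp [stdVec, CliffordAlgebra.reverse_ι]

theorem prod_stdVec_mul_reverse {n : ℕ} (l : List (Fin n)) :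
    ((l.map stdVec).prod * (l.reverse.map stdVec).prod : Cl n) = 1 := by
  induction l with
  | nil => simp
  | cons i l ih =>
    rw [List.map_cons, List.prod_cons, List.reverse_cons, List.map_append, List.prod_append,
      mul_assoc, ← mul_assoc _ _ ((List.map stdVec [i]).prod), ih]
    simp [stdVec_mul_self]

theorem blade_mul_rev {n : ℕ} (A : Finset (Fin n)) : blade A * rev (blade A) = (1 : Cl n) := by
  rw [blade, rev_prod_stdVec, prod_stdVec_mul_reverse]

theorem rev_blade {n : ℕ} (A : Finset (Fin n)) :
    rev (blade A) = (blade A : Cl n) ∨ rev (blade A) = -(blade A : Cl n) := by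
  rw [blade, rev_prod_stdVec]
  exact prod_stdVec_eq_or_neg_of_perm (List.reverse_perm _)
    (List.nodup_reverse.2 (Finset.sort_nodup _ _))

@[simp] theorem blade_empty {n : ℕ} : (blade ∅ : Cl n) = 1 := by simp [blade]

/-! ### Reversion, scalar part and modulus -/

/-- Reversion as a linear map. -/
def revL (n : ℕ) : Cl n →L[ℝ] Cl n :=
  LinearMap.toContinuousLinearMap (CliffordAlgebra.reverse (Q := quadForm n))

theorem revL_apply {n : ℕ} (M : Cl n) : revL n M = rev M := rfl

theorem continuous_rev {n : ℕ} : Continuous (rev : Cl n → Cl n) := (revL n).continuous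

@[simp] theorem rev_mul {n : ℕ} (M N : Cl n) : rev (M * N) = rev N * rev M :=
  CliffordAlgebra.reverse.map_mul M N

@[simp] theorem rev_rev {n : ℕ} (M : Cl n) : rev (rev M) = M :=
  CliffordAlgebra.reverse_reverse M

@[simp] theorem rev_one {n : ℕ} : rev (1 : Cl n) = 1 := CliffordAlgebra.reverse.map_one

@[simp] theorem rev_smul {n : ℕ} (c : ℝ) (M : Cl n) : rev (c • M) = c • rev M :=
  map_smul (revL n) c M

@[simp] theorem rev_neg {n : ℕ} (M : Cl n) : rev (-M) = -rev M := map_neg (revL n) M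

@[simp] theorem rev_add {n : ℕ} (M N : Cl n) : rev (M + N) = rev M + rev N := map_add (revL n) M N

/-- The coordinate `M_A` of a multivector, as a continuous linear functional. -/
def coordL {n : ℕ} (A : Finset (Fin n)) : Cl n →L[ℝ] ℝ :=
  LinearMap.toContinuousLinearMap ((bladeBasis n).coord A)

theorem coordL_apply {n : ℕ} (A : Finset (Fin n)) (M : Cl n) :
    coordL A M = coords n M A := rfl

theorem coordL_blade {n : ℕ} (A B : Finset (Fin n)) :
    coordL A (blade B : Cl n) = if B = A then 1 else 0 := by
  rw [← bladeBasis_apply]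
  simp [coordL, Finsupp.single_apply]

theorem sum_coordL_smul_blade {n : ℕ} (M : Cl n) : ∑ A, coordL A M • blade A = M := by
  simp_rw [← bladeBasis_apply]
  exact (bladeBasis n).sum_repr M

theorem ext_coordL {n : ℕ} {M N : Cl n} (h : ∀ A, coordL A M = coordL A N) : M = N := by
  rw [← sum_coordL_smul_blade M, ← sum_coordL_smul_blade N]
  simp [h]

theorem norm_sq_eq_sum_coordL {n : ℕ} (M : Cl n) : ‖M‖ ^ 2 = ∑ A, coordL A M ^ 2 := by
  change ‖coords n M‖ ^ 2 = _
  rw [EuclideanSpace.norm_sq_eq]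
  simp [coordL_apply]

/-- For `A ≠ B` the product is `±e_{A △ B}` with `A △ B` nonempty. Hence the scalar part of `M Ñ` is
the Euclidean inner product behind the modulus. -/
theorem coordL_empty_blade_mul_rev {n : ℕ} (A B : Finset (Fin n)) :
    coordL ∅ (blade A * rev (blade B) : Cl n) = if A = B then 1 else 0 := by
  split_ifs with h
  · rw [h, blade_mul_rev, ← blade_empty, coordL_blade, if_pos rfl]
  · have h' : symmDiff A B ≠ ∅ := fun h' => h (symmDiff_eq_bot.1 h')
    rcases rev_blade B with hB | hB <;> rcases blade_mul_blade A B with hAB | hAB <;>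
      simp [hB, hAB, coordL_blade, h']

theorem coordL_empty_mul_rev {n : ℕ} (M N : Cl n) :
    coordL ∅ (M * rev N) = ∑ A, coordL A M * coordL A N := by
  conv_lhs => rw [← sum_coordL_smul_blade M, ← sum_coordL_smul_blade N]
  simp_rw [← revL_apply, map_sum, map_smul, Finset.sum_mul, Finset.mul_sum, map_sum,
    smul_mul_smul_comm, map_smul, revL_apply, coordL_empty_blade_mul_rev]
  simp

theorem coordL_empty_mul_rev_self {n : ℕ} (M : Cl n) : coordL ∅ (M * rev M) = ‖M‖ ^ 2 := by
  rw [coordL_empty_mul_rev, norm_sq_eq_sum_coordL]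
  simp [sq]

/-- Reversion is diagonal in the blades with eigenvalues `±1`, which makes it an isometry. -/
theorem coordL_rev {n : ℕ} (A : Finset (Fin n)) (M : Cl n) :
    coordL A (rev M) ^ 2 = coordL A M ^ 2 := by
  have h : ∀ B, coordL A (rev (blade B) : Cl n) =
      coordL B (rev (blade B) : Cl n) * if B = A then 1 else 0 := by
    intro B
    rcases rev_blade B with hB | hB <;> by_cases hBA : B = A <;> simp [hB, coordL_blade, hBA]
  have h2 : coordL A (rev (blade A) : Cl n) ^ 2 = 1 := by
    rcases rev_blade A with hB | hB <;> simp [hB, coordL_blade]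
  conv_lhs => rw [← sum_coordL_smul_blade M]
  simp_rw [← revL_apply, map_sum, map_smul, revL_apply, h]
  simp [mul_pow, h2]

@[simp] theorem norm_rev {n : ℕ} (M : Cl n) : ‖rev M‖ = ‖M‖ := by
  rw [← sq_eq_sq₀ (norm_nonneg _) (norm_nonneg _), norm_sq_eq_sum_coordL, norm_sq_eq_sum_coordL]
  simp [coordL_rev]

theorem coordL_empty_rev_mul_self {n : ℕ} (M : Cl n) : coordL ∅ (rev M * M) = ‖M‖ ^ 2 := by
  have := coordL_empty_mul_rev_self (rev M)
  rwa [rev_rev, norm_rev] at this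

/-- The coordinates of `M Ñ` are inner products of `M` with left multiples of `N`. -/
theorem coordL_mul_rev {n : ℕ} (A : Finset (Fin n)) (M N : Cl n) :
    coordL A (M * rev N) = ∑ B, coordL B M * coordL B (blade A * N) := by
  -- Both sides are the scalar part of `M Ñ ẽ_A`, with `ẽ_A` absorbed into the reverse of `e_A N` or
  -- kept as a separate factor.
  rw [← coordL_empty_mul_rev, rev_mul, ← mul_assoc, coordL_empty_mul_rev]
  simp [coordL_blade]

/-! ### Multiplication as a bounded bilinear map -/

/-- Multiplication as a continuous bilinear map. -/
def mulL (n : ℕ) : Cl n →L[ℝ] Cl n →L[ℝ] Cl n :=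
  LinearMap.toContinuousLinearMap
    ((LinearMap.toContinuousLinearMap : (Cl n →ₗ[ℝ] Cl n) ≃ₗ[ℝ] (Cl n →L[ℝ] Cl n)).toLinearMap
      ∘ₗ LinearMap.mul ℝ (Cl n))

theorem mulL_apply {n : ℕ} (M N : Cl n) : mulL n M N = M * N := rfl

theorem norm_mul_le_mulL {n : ℕ} (M N : Cl n) : ‖M * N‖ ≤ ‖mulL n‖ * ‖M‖ * ‖N‖ :=
  (mulL n).le_opNorm₂ M N

/-! ### The pseudoscalar -/

theorem prod_stdVec_mul_stdVec_of_notMem {n : ℕ} (l : List (Fin n)) {i : Fin n} (hi : i ∉ l) :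
    ((l.map stdVec).prod * stdVec i : Cl n) =
      (-1 : ℝ) ^ l.length • (stdVec i * (l.map stdVec).prod) := by
  induction l with
  | nil => simp
  | cons j l ih =>
    have hj : j ≠ i := fun h => hi (by simp [h])
    have hl : i ∉ l := fun h => hi (by simp [h])
    rw [List.map_cons, List.prod_cons, mul_assoc, ih hl, mul_smul_comm, ← mul_assoc,
      stdVec_mul_anticomm hj, List.length_cons, pow_succ]
    simp [mul_assoc]

/-- All factors but `e_i` itself anticommute with `e_i`, giving `length - 1` signs; the exponent
`length + 1` has the same parity without natural subtraction. -/
theorem prod_stdVec_mul_stdVec_of_mem {n : ℕ} (l : List (Fin n)) (hl : l.Nodup) {i : Fin n}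
    (hi : i ∈ l) :
    ((l.map stdVec).prod * stdVec i : Cl n) =
      (-1 : ℝ) ^ (l.length + 1) • (stdVec i * (l.map stdVec).prod) := by
  induction l with
  | nil => simp at hi
  | cons j l ih =>
    have hn := List.nodup_cons.1 hl
    rw [List.map_cons, List.prod_cons, mul_assoc]
    by_cases hj : j = i
    · subst hj
      rw [prod_stdVec_mul_stdVec_of_notMem l hn.1, List.length_cons, mul_smul_comm, pow_add,
        pow_add]
      simp
    · have hil : i ∈ l := by
        rcases List.mem_cons.1 hi with h | h
        · exact absurd h.symm hj
        · exact h
      rw [ih hn.2 hil, mul_smul_comm, ← mul_assoc, stdVec_mul_anticomm hj, List.length_cons,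
        pow_succ (-1 : ℝ) (l.length + 1)]
      simp [mul_assoc]

theorem prod_stdVec_reverse {n : ℕ} (l : List (Fin n)) (hl : l.Nodup) :
    ((l.reverse.map stdVec).prod : Cl n) =
      (-1 : ℝ) ^ (l.length * (l.length - 1) / 2) • (l.map stdVec).prod := by
  induction l with
  | nil => simp
  | cons i l ih =>
    have hn := List.nodup_cons.1 hl
    rw [List.reverse_cons, List.map_append, List.prod_append, ih hn.2]
    -- Recursion of the triangular numbers, read off from `∑_{i<m} i = m(m-1)/2`.
    have h : (l.length + 1) * l.length / 2 = l.length * (l.length - 1) / 2 + l.length := by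
      have h := Finset.sum_range_succ (fun i => i) l.length
      rw [Finset.sum_range_id, Finset.sum_range_id] at h
      simpa using h
    simp [prod_stdVec_mul_stdVec_of_notMem l hn.1, h, pow_add, smul_smul]

theorem rev_pseudoscalar {n : ℕ} (hn : n % 4 = 2 ∨ n % 4 = 3) :
    rev (pseudoscalar n) = -pseudoscalar n := by
  rw [pseudoscalar, blade, rev_prod_stdVec, prod_stdVec_reverse _ (Finset.sort_nodup _ _)]
  -- The residues 2 and 3 modulo 4 enter here: they make the number of transpositions in the
  -- reversal odd.
  have h : Odd (n * (n - 1) / 2) := by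
    rcases hn with h | h
    · obtain ⟨k, rfl⟩ : ∃ k, n = 4 * k + 2 := ⟨n / 4, by omega⟩
      have : (4 * k + 2) * (4 * k + 2 - 1) = 2 * ((2 * k + 1) * (4 * k + 1)) := by
        rw [show 4 * k + 2 - 1 = 4 * k + 1 by omega]; ring
      rw [this, Nat.mul_div_cancel_left _ two_pos]
      exact Odd.mul ⟨k, by ring⟩ ⟨2 * k, by ring⟩
    · obtain ⟨k, rfl⟩ : ∃ k, n = 4 * k + 3 := ⟨n / 4, by omega⟩
      have : (4 * k + 3) * (4 * k + 3 - 1) = 2 * ((4 * k + 3) * (2 * k + 1)) := by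
        rw [show 4 * k + 3 - 1 = 4 * k + 2 by omega]; ring
      rw [this, Nat.mul_div_cancel_left _ two_pos]
      exact Odd.mul ⟨2 * k + 1, by ring⟩ ⟨k, by ring⟩
  simp [h.neg_one_pow]

theorem pseudoscalar_mul_self {n : ℕ} (hn : n % 4 = 2 ∨ n % 4 = 3) :
    pseudoscalar n * pseudoscalar n = -1 := by
  have h := blade_mul_rev (Finset.univ : Finset (Fin n))
  change pseudoscalar n * rev (pseudoscalar n) = 1 at h
  rw [rev_pseudoscalar hn, mul_neg] at h
  rw [← h, neg_neg]

theorem pseudoscalar_mul_stdVec {n : ℕ} (i : Fin n) :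
    pseudoscalar n * stdVec i = (-1 : ℝ) ^ (n + 1) • (stdVec i * pseudoscalar n) := by
  have h := prod_stdVec_mul_stdVec_of_mem (Finset.univ.sort (· ≤ ·)) (Finset.sort_nodup _ _)
    (i := i) (by simp)
  rw [← blade] at h
  simpa [pseudoscalar] using h

theorem pseudoscalar_mul_ι {n : ℕ} (v : E n) :
    pseudoscalar n * CliffordAlgebra.ι (quadForm n) v =
      (-1 : ℝ) ^ (n + 1) • (CliffordAlgebra.ι (quadForm n) v * pseudoscalar n) := by
  rw [← (EuclideanSpace.basisFun (Fin n) ℝ).sum_repr v]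
  simp_rw [map_sum, map_smul, Finset.mul_sum, Finset.sum_mul, Finset.smul_sum]
  refine Finset.sum_congr rfl fun i _ => ?_
  rw [mul_smul_comm, smul_mul_assoc, smul_comm ((-1 : ℝ) ^ (n + 1))]
  congr 1
  exact pseudoscalar_mul_stdVec i

theorem pseudoscalar_mul_of_odd {n : ℕ} (hn : n % 2 = 1) (M : Cl n) :
    pseudoscalar n * M = M * pseudoscalar n := by
  have he : (-1 : ℝ) ^ (n + 1) = 1 := Even.neg_one_pow (Nat.even_iff.2 (by omega))
  induction M using CliffordAlgebra.induction with
  | algebraMap r => exact (Algebra.commutes r _).symm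
  | ι v => rw [pseudoscalar_mul_ι, he, one_smul]
  | mul a b ha hb => rw [← mul_assoc, ha, mul_assoc, hb, mul_assoc]
  | add a b ha hb => rw [mul_add, add_mul, ha, hb]

theorem pseudoscalar_mul_of_even {n : ℕ} (hn : n % 2 = 0) (M : Cl n) :
    pseudoscalar n * M = CliffordAlgebra.involute M * pseudoscalar n := by
  have he : (-1 : ℝ) ^ (n + 1) = -1 := Odd.neg_one_pow (Nat.odd_iff.2 (by omega))
  induction M using CliffordAlgebra.induction with
  | algebraMap r => rw [AlgHom.commutes]; exact (Algebra.commutes r _).symm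
  | ι v => rw [pseudoscalar_mul_ι, he]; simp
  | mul a b ha hb => rw [← mul_assoc, ha, mul_assoc, hb, map_mul, mul_assoc]
  | add a b ha hb => rw [mul_add, map_add, add_mul, ha, hb]

/-! ### The complex structure given by the pseudoscalar -/

/-- The embedding of `ℂ` into `Cl_n` that sends the imaginary unit to the pseudoscalar. -/
def complexHom {n : ℕ} (hn : n % 4 = 2 ∨ n % 4 = 3) : ℂ →ₐ[ℝ] Cl n :=
  Complex.lift ⟨pseudoscalar n, pseudoscalar_mul_self hn⟩

theorem complexHom_apply {n : ℕ} (hn : n % 4 = 2 ∨ n % 4 = 3) (z : ℂ) :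
    complexHom hn z = z.re • (1 : Cl n) + z.im • pseudoscalar n := by
  simp [complexHom, Complex.liftAux_apply, Algebra.algebraMap_eq_smul_one]

theorem continuous_complexHom {n : ℕ} (hn : n % 4 = 2 ∨ n % 4 = 3) :
    Continuous (complexHom hn) :=
  LinearMap.continuous_of_finiteDimensional (complexHom hn).toLinearMap

theorem exp_smul_pseudoscalar {n : ℕ} (hn : n % 4 = 2 ∨ n % 4 = 3) (t : ℝ) :
    NormedSpace.exp (t • pseudoscalar n) = complexHom hn (Complex.exp (t * Complex.I)) := by
  have h := (NormedSpace.exp_series_hasSum_exp' (𝕂 := ℝ) (t * Complex.I : ℂ)).map (complexHom hn)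
    (continuous_complexHom hn)
  have ht : complexHom hn (t * Complex.I) = t • pseudoscalar n := by simp [complexHom_apply]
  rw [Complex.exp_eq_exp_ℂ, ← h.tsum_eq, NormedSpace.exp_eq_tsum ℝ]
  simp only [Function.comp_apply, map_smul, map_pow, ht]

theorem rev_complexHom {n : ℕ} (hn : n % 4 = 2 ∨ n % 4 = 3) (z : ℂ) :
    rev (complexHom hn z) = complexHom hn (starRingEnd ℂ z) := by
  simp [complexHom_apply, rev_pseudoscalar hn]

/-- The scalar part of `M z z̄ M̃` is `|z|²` times that of `M M̃`, because `z z̄` is a real scalar.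
-/
theorem norm_mul_complexHom {n : ℕ} (hn : n % 4 = 2 ∨ n % 4 = 3) (M : Cl n) (z : ℂ) :
    ‖M * complexHom hn z‖ = ‖M‖ * ‖z‖ := by
  rw [← sq_eq_sq₀ (norm_nonneg _) (by positivity), mul_pow, ← coordL_empty_mul_rev_self, rev_mul,
    rev_complexHom, mul_assoc, ← mul_assoc (complexHom hn z), ← map_mul, Complex.mul_conj,
    Complex.normSq_eq_norm_sq, complexHom_apply]
  simp only [Complex.ofReal_re, Complex.ofReal_im, zero_smul, add_zero, smul_mul_assoc, one_mul,
    mul_smul_comm, map_smul, coordL_empty_mul_rev_self, smul_eq_mul]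
  ring

/-- Moving `M` across multiplies the `i_n` component by `ε`; since cosine is even and sine is odd,
this amounts to `t ↦ ε t`. -/
theorem complexHom_mul {n : ℕ} (hn : n % 4 = 2 ∨ n % 4 = 3) {M : Cl n} {ε : ℝ}
    (h : pseudoscalar n * M = ε • (M * pseudoscalar n)) (t : ℝ) (hε : ε = 1 ∨ ε = -1) :
    complexHom hn (Complex.exp (t * Complex.I)) * M =
      M * complexHom hn (Complex.exp ((ε * t : ℝ) * Complex.I)) := by
  rw [complexHom_apply, complexHom_apply, add_mul, mul_add, smul_mul_assoc, smul_mul_assoc, h,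
    mul_smul_comm, mul_smul_comm, one_mul, mul_one]
  simp only [Complex.exp_ofReal_mul_I_re, Complex.exp_ofReal_mul_I_im]
  rcases hε with rfl | rfl <;> simp

/-! ### The Plancherel theorem for integrable, square integrable functions -/

section Fourier

open FourierTransform SchwartzMap
open scoped ContDiff

variable {V H : Type*} [NormedAddCommGroup V] [InnerProductSpace ℝ V] [FiniteDimensional ℝ V]
  [MeasurableSpace V] [BorelSpace V] [NormedAddCommGroup H] [InnerProductSpace ℂ H]
  [CompleteSpace H]

/-- The `L²` transform agrees with the Fourier integral: both are tested against compactly supported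
smooth functions, and the transform is moved onto the test function on either side. -/
theorem fourier_toLp_ae_eq {f : V → H} (h₁ : Integrable f) (h₂ : MemLp f 2) :
    ((𝓕 (h₂.toLp f) : Lp H 2 (volume : Measure V)) : V → H) =ᵐ[volume] 𝓕 f := by
  have hc : Continuous (𝓕 f) :=
    VectorFourier.fourierIntegral_continuous Real.continuous_fourierChar
      (by exact continuous_inner) h₁
  refine ae_eq_of_integral_contDiff_smul_eq
    ((Lp.memLp _).locallyIntegrable (by norm_num)) hc.locallyIntegrable fun g hg hgc => ?_
  have hg₁ : HasCompactSupport (Complex.ofRealCLM ∘ g) := hgc.comp_left rfl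
  have hg₂ : ContDiff ℝ ∞ (Complex.ofRealCLM ∘ g) := by fun_prop
  set φ : 𝓢(V, ℂ) := hg₁.toSchwartzMap hg₂ with hφ
  have hφg : ∀ x, φ x = (g x : ℂ) := fun x => rfl
  have e₁ : ∫ x, g x • (𝓕 (h₂.toLp f) : Lp H 2 (volume : Measure V)) x =
      ((𝓕 (h₂.toLp f) : Lp H 2 (volume : Measure V)) : 𝓢'(V, H)) φ := by
    rw [Lp.toTemperedDistribution_apply]
    simp [hφg]
  rw [e₁, ← Lp.fourier_toTemperedDistribution_eq, TemperedDistribution.fourier_apply,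
    Lp.toTemperedDistribution_apply]
  have e₂ : ∫ x, (𝓕 φ) x • (h₂.toLp f : Lp H 2 (volume : Measure V)) x = ∫ x, (𝓕 φ) x • f x := by
    refine integral_congr_ae ?_
    filter_upwards [h₂.coeFn_toLp] with x hx
    rw [hx]
  rw [e₂]
  have := VectorFourier.integral_fourierIntegral_smul_eq_flip (L := innerₗ V)
    (μ := (volume : Measure V)) (ν := (volume : Measure V)) (f := φ) (g := f)
    Real.continuous_fourierChar (by exact continuous_inner) φ.integrable h₁
  rw [flip_innerₗ] at this
  refine Eq.trans this ?_
  simp only [hφg, Complex.coe_smul]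
  rfl

theorem memLp_fourier {f : V → H} (h₁ : Integrable f) (h₂ : MemLp f 2) :
    MemLp (𝓕 f) 2 :=
  (memLp_congr_ae (fourier_toLp_ae_eq h₁ h₂)).1 (Lp.memLp _)

theorem eLpNorm_fourier {f : V → H} (h₁ : Integrable f) (h₂ : MemLp f 2) :
    eLpNorm (𝓕 f) 2 = eLpNorm f 2 := by
  have h := Lp.norm_fourier_eq (h₂.toLp f)
  rw [Lp.norm_def, Lp.norm_def, ENNReal.toReal_eq_toReal_iff' (Lp.eLpNorm_ne_top _)
    (Lp.eLpNorm_ne_top _)] at h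
  rw [← eLpNorm_congr_ae (fourier_toLp_ae_eq h₁ h₂), h, eLpNorm_congr_ae h₂.coeFn_toLp]

end Fourier

theorem eLpNorm_comp_smul {n : ℕ} {X : Type*} [NormedAddCommGroup X] (g : E n → X) {s : ℝ}
    (hs : s ≠ 0) :
    eLpNorm (fun x => g (s • x)) 2 volume =
      ENNReal.ofReal (|s ^ n|⁻¹) ^ (1 / 2 : ℝ) * eLpNorm g 2 volume := by
  have he : MeasurableEmbedding fun x : E n => s • x :=
    (Homeomorph.smulOfNeZero s hs).measurableEmbedding
  have h := he.eLpNorm_map_measure (μ := volume) (g := g) (p := 2)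
  have hm := Measure.map_addHaar_smul (volume : Measure (E n)) hs
  rw [hm, eLpNorm_smul_measure_of_ne_top (by norm_num)] at h
  rw [show (fun x => g (s • x)) = g ∘ fun x => s • x from rfl, ← h]
  simp

/-! ### The Clifford Fourier integral -/

/-- The Clifford Fourier integral `∫ f(x) e^{-i_n ω·x} dⁿx`. -/
def cftInt {n : ℕ} (f : E n → Cl n) (ω : E n) : Cl n :=
  ∫ x, f x * NormedSpace.exp (-(inner ℝ ω x) • pseudoscalar n)

/-- The constant `(2π)^{n/2}` in the Plancherel identity. -/
def plancherelConst (n : ℕ) : ENNReal := ENNReal.ofReal ((2 * Real.pi) ^ n) ^ (1 / 2 : ℝ)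

theorem plancherelConst_ne_top (n : ℕ) : plancherelConst n ≠ ⊤ :=
  ENNReal.rpow_ne_top_of_nonneg (by norm_num) ENNReal.ofReal_ne_top

theorem plancherelConst_sq (n : ℕ) :
    plancherelConst n ^ 2 = ENNReal.ofReal ((2 * Real.pi) ^ n) := by
  rw [plancherelConst, ← ENNReal.rpow_natCast, ← ENNReal.rpow_mul]
  norm_num

/-- An embedding `M ↦ M - i (M i_n)` of `Cl_n` into a complex Hilbert space that turns right
multiplication by `i_n` into multiplication by `i`. -/
def complexCoords (n : ℕ) : Cl n →L[ℝ] EuclideanSpace ℂ (Finset (Fin n)) :=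
  LinearMap.toContinuousLinearMap
    { toFun := fun M => WithLp.toLp 2 fun A =>
        (coordL A M : ℂ) - Complex.I * (coordL A (M * pseudoscalar n) : ℂ)
      map_add' := fun M N => by
        ext A
        simp [add_mul]
        ring
      map_smul' := fun c M => by
        ext A
        simp
        ring }

theorem complexCoords_apply {n : ℕ} (M : Cl n) (A : Finset (Fin n)) :
    complexCoords n M A =
      (coordL A M : ℂ) - Complex.I * (coordL A (M * pseudoscalar n) : ℂ) := rfl

/-- A left inverse of `complexCoords`. -/
def ofComplexCoords (n : ℕ) : EuclideanSpace ℂ (Finset (Fin n)) →L[ℝ] Cl n :=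
  LinearMap.toContinuousLinearMap
    { toFun := fun z => ∑ A, (z A).re • blade A
      map_add' := fun z w => by simp [add_smul, Finset.sum_add_distrib]
      map_smul' := fun c z => by simp [Finset.smul_sum, smul_smul] }

theorem ofComplexCoords_complexCoords {n : ℕ} (M : Cl n) :
    ofComplexCoords n (complexCoords n M) = M := by
  change ∑ A, (complexCoords n M A).re • blade A = M
  simp [complexCoords_apply, sum_coordL_smul_blade]

section

variable {n : ℕ} (hn : n % 4 = 2 ∨ n % 4 = 3)

include hn

theorem complexCoords_mul_complexHom (M : Cl n) (z : ℂ) :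
    complexCoords n (M * complexHom hn z) = z • complexCoords n M := by
  ext A
  have h : M * complexHom hn z * pseudoscalar n =
      z.re • (M * pseudoscalar n) - z.im • M := by
    rw [complexHom_apply, mul_add, add_mul, mul_smul_comm, mul_smul_comm, smul_mul_assoc,
      smul_mul_assoc, mul_assoc M (pseudoscalar n), pseudoscalar_mul_self hn]
    simp [sub_eq_add_neg]
  rw [complexCoords_apply, h, complexHom_apply, mul_add, mul_smul_comm, mul_smul_comm]
  simp only [mul_one, map_add, map_sub, map_smul, PiLp.smul_apply, complexCoords_apply]
  apply Complex.ext
  · simp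
  · simp
    ring

/-- The real and imaginary parts have norms `|M|` and `|M i_n|`, which are equal. -/
theorem norm_complexCoords (M : Cl n) : ‖complexCoords n M‖ = √2 * ‖M‖ := by
  rw [← sq_eq_sq₀ (norm_nonneg _) (by positivity), mul_pow, Real.sq_sqrt (by norm_num),
    EuclideanSpace.norm_sq_eq]
  have h : ∀ A, ‖complexCoords n M A‖ ^ 2 =
      coordL A M ^ 2 + coordL A (M * pseudoscalar n) ^ 2 := by
    intro A
    rw [complexCoords_apply, ← Complex.normSq_eq_norm_sq, Complex.normSq_apply]
    simp
    ring
  have hi : pseudoscalar n = complexHom hn Complex.I := by simp [complexHom_apply]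
  simp_rw [h]
  rw [Finset.sum_add_distrib, ← norm_sq_eq_sum_coordL, ← norm_sq_eq_sum_coordL, hi,
    norm_mul_complexHom]
  simp
  ring

theorem eLpNorm_complexCoords_comp (f : E n → Cl n) :
    eLpNorm (fun x => complexCoords n (f x)) 2 volume =
      ENNReal.ofReal √2 * eLpNorm f 2 volume := by
  rw [eLpNorm_congr_norm_ae (g := fun x => √2 • f x)
    (ae_of_all _ fun x => by
      rw [norm_complexCoords hn, norm_smul, Real.norm_of_nonneg (by positivity)])]
  rw [show (fun x => √2 • f x) = √2 • f from rfl, eLpNorm_const_smul,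
    Real.enorm_of_nonneg (by positivity)]

theorem mul_exp_eq (M : Cl n) (t : ℝ) :
    M * NormedSpace.exp (-t • pseudoscalar n) =
      M * complexHom hn (Complex.exp ((-t : ℝ) * Complex.I)) := by
  rw [exp_smul_pseudoscalar hn]

theorem continuous_exp_inner (ω : E n) :
    Continuous fun x : E n => NormedSpace.exp (-(inner ℝ ω x) • pseudoscalar n) := by
  simp_rw [exp_smul_pseudoscalar hn]
  exact (continuous_complexHom hn).comp (by fun_prop)

theorem norm_mul_exp (M : Cl n) (t : ℝ) :
    ‖M * NormedSpace.exp (t • pseudoscalar n)‖ = ‖M‖ := by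
  rw [exp_smul_pseudoscalar hn, norm_mul_complexHom, Complex.norm_exp_ofReal_mul_I, mul_one]

theorem integrable_mul_exp {f : E n → Cl n} (hf : Integrable f) (ω : E n) :
    Integrable fun x => f x * NormedSpace.exp (-(inner ℝ ω x) • pseudoscalar n) :=
  hf.congr' (hf.1.mul (continuous_exp_inner hn ω).aestronglyMeasurable)
    (ae_of_all _ fun _ => (norm_mul_exp hn _ _).symm)

open FourierTransform in
theorem complexCoords_cftInt {f : E n → Cl n} (hf : Integrable f) (ω : E n) :
    complexCoords n (cftInt f ω) = 𝓕 (fun x => complexCoords n (f x)) ((2 * Real.pi)⁻¹ • ω) := by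
  rw [cftInt, ← ContinuousLinearMap.integral_comp_comm _ (integrable_mul_exp hn hf ω),
    Real.fourier_eq']
  refine integral_congr_ae (ae_of_all _ fun x => ?_)
  dsimp only
  rw [mul_exp_eq hn, complexCoords_mul_complexHom]
  congr 3
  rw [real_inner_comm, inner_smul_right]
  have := Real.pi_ne_zero
  push_cast
  field_simp

/-- Plancherel transported through `complexCoords`. The factors `√2` cancel, and the constant comes
from the dilation by `(2π)⁻¹` that relates the kernels `e^{-iω·x}` and `e^{-2πiω·x}`. -/
theorem memLp_cftInt {f : E n → Cl n} (h₁ : Integrable f) (h₂ : MemLp f 2) :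
    MemLp (cftInt f) 2 ∧ eLpNorm (cftInt f) 2 volume = plancherelConst n * eLpNorm f 2 volume := by
  have hs : (2 * Real.pi)⁻¹ ≠ 0 := by positivity
  have hΦ₁ : Integrable fun x => complexCoords n (f x) := (complexCoords n).integrable_comp h₁
  have hΦ₂ : MemLp (fun x => complexCoords n (f x)) 2 := (complexCoords n).comp_memLp' h₂
  have hF := memLp_fourier hΦ₁ hΦ₂
  have hsc := eLpNorm_comp_smul (FourierTransform.fourier fun x => complexCoords n (f x)) hs
  have hmeas : AEStronglyMeasurable (fun ω : E n =>
      FourierTransform.fourier (fun x => complexCoords n (f x)) ((2 * Real.pi)⁻¹ • ω)) volume :=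
    hF.1.comp_quasiMeasurePreserving
      (Measure.quasiMeasurePreserving_smul (volume : Measure (E n)) hs)
  simp_rw [← complexCoords_cftInt hn h₁] at hsc hmeas
  rw [eLpNorm_fourier hΦ₁ hΦ₂, eLpNorm_complexCoords_comp hn, eLpNorm_complexCoords_comp hn] at hsc
  have hsc' : eLpNorm (cftInt f) 2 volume = plancherelConst n * eLpNorm f 2 volume := by
    have h2 : ENNReal.ofReal √2 ≠ 0 := by simp
    rw [mul_left_comm] at hsc
    rw [(ENNReal.mul_right_inj h2 ENNReal.ofReal_ne_top).1 hsc, plancherelConst]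
    congr 3
    rw [inv_pow, abs_inv, inv_inv, abs_of_nonneg (by positivity)]
  refine ⟨⟨?_, ?_⟩, hsc'⟩
  -- Measurability is known for the image under `complexCoords`; the continuous left inverse brings
  -- it back.
  · have := (ofComplexCoords n).continuous.comp_aestronglyMeasurable hmeas
    simpa only [ofComplexCoords_complexCoords] using this
  · rw [hsc']
    exact ENNReal.mul_lt_top (plancherelConst_ne_top n).lt_top h₂.2

end

/-! ### Truncations -/

theorem memLp_indicator_ball {n : ℕ} {f : E n → Cl n} (hf : MemLp f 2) (R : ℝ) :
    MemLp ((Metric.ball (0 : E n) R).indicator f) 2 :=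
  hf.indicator measurableSet_ball

theorem integrable_indicator_ball {n : ℕ} {f : E n → Cl n} (hf : MemLp f 2) (R : ℝ) :
    Integrable ((Metric.ball (0 : E n) R).indicator f) := by
  have : IsFiniteMeasure ((volume : Measure (E n)).restrict (Metric.ball (0 : E n) R)) :=
    ⟨by simpa using measure_ball_lt_top⟩
  exact (integrable_indicator_iff measurableSet_ball).2
    ((hf.restrict _).integrable (by norm_num))

theorem tendsto_eLpNorm_sub_indicator_ball {n : ℕ} {f : E n → Cl n} (hf : MemLp f 2) :
    Tendsto (fun R : ℝ => eLpNorm (f - (Metric.ball (0 : E n) R).indicator f) 2 volume) atTop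
      (𝓝 0) := by
  have h2 : (2 : ENNReal) ≠ 0 := by norm_num
  have h2' : (2 : ENNReal) ≠ ⊤ := by norm_num
  simp_rw [eLpNorm_eq_lintegral_rpow_enorm_toReal h2 h2']
  have hfin : ∫⁻ x, ‖f x‖ₑ ^ (2 : ENNReal).toReal ≠ ⊤ :=
    (lintegral_rpow_enorm_lt_top_of_eLpNorm_lt_top h2 h2' hf.2).ne
  have key : Tendsto (fun R : ℝ => ∫⁻ x,
      ‖(f - (Metric.ball (0 : E n) R).indicator f) x‖ₑ ^ (2 : ENNReal).toReal) atTop (𝓝 0) := by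
    rw [← lintegral_zero (μ := (volume : Measure (E n)))]
    refine tendsto_of_seq_tendsto fun R hR => ?_
    refine tendsto_lintegral_of_dominated_convergence'
      (fun x => ‖f x‖ₑ ^ (2 : ENNReal).toReal) (fun k => ?_)
      (fun k => ae_of_all _ fun x => ?_) hfin (ae_of_all _ fun x => ?_)
    · exact ((hf.1.sub (memLp_indicator_ball hf (R k)).1).enorm).pow_const _
    · by_cases hx : x ∈ Metric.ball (0 : E n) (R k)
      · simp [Set.indicator_of_mem hx]
      · simp [Set.indicator_of_notMem hx]
    · refine tendsto_const_nhds.congr' ?_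
      filter_upwards [hR.eventually_gt_atTop ‖x‖] with k hk
      have hx : x ∈ Metric.ball (0 : E n) (R k) := by simpa using hk
      simp [Set.indicator_of_mem hx]
  have := (ENNReal.continuous_rpow_const (y := 1 / (2 : ENNReal).toReal)).tendsto 0 |>.comp key
  simpa [Function.comp_def] using this

theorem setIntegral_ball_eq_cftInt {n : ℕ} (f : E n → Cl n) (R : ℝ) (ω : E n) :
    ∫ x in Metric.ball (0 : E n) R, f x * NormedSpace.exp (-(inner ℝ ω x) • pseudoscalar n) =
      cftInt ((Metric.ball (0 : E n) R).indicator f) ω := by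
  rw [cftInt, ← integral_indicator measurableSet_ball]
  congr 1 with x
  by_cases hx : x ∈ Metric.ball (0 : E n) R
  · simp only [Set.indicator_of_mem hx]
  · simp only [Set.indicator_of_notMem hx, zero_mul]

theorem IsCFT.tendsto_cftInt {n : ℕ} {f F : E n → Cl n} (h : IsCFT f F) :
    Tendsto (fun R : ℝ => eLpNorm (F - cftInt ((Metric.ball (0 : E n) R).indicator f)) 2 volume)
      atTop (𝓝 0) := by
  have := h.tendsto
  simp_rw [setIntegral_ball_eq_cftInt] at this
  exact this

theorem isCFT_of_tendsto_cftInt {n : ℕ} {f F : E n → Cl n} (hF : MemLp F 2)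
    (h : Tendsto (fun R : ℝ =>
      eLpNorm (F - cftInt ((Metric.ball (0 : E n) R).indicator f)) 2 volume) atTop (𝓝 0)) :
    IsCFT f F := by
  refine ⟨hF, ?_⟩
  simp_rw [setIntegral_ball_eq_cftInt]
  exact h

theorem tendsto_eLpNorm_of_tendsto_eLpNorm_sub {n : ℕ} {ι : Type*} {l : Filter ι}
    {F : E n → Cl n} {G : ι → E n → Cl n} (hF : MemLp F 2) (hG : ∀ k, MemLp (G k) 2)
    (h : Tendsto (fun k => eLpNorm (F - G k) 2 volume) l (𝓝 0)) :
    Tendsto (fun k => eLpNorm (G k) 2 volume) l (𝓝 (eLpNorm F 2 volume)) := by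
  have h' : Tendsto (fun k => (hG k).toLp (G k)) l (𝓝 (hF.toLp F)) := by
    refine (Lp.tendsto_Lp_iff_tendsto_eLpNorm'' G hG F hF).2 ?_
    simpa only [eLpNorm_sub_comm] using h
  have := (continuous_enorm.tendsto _).comp h'
  simpa [Function.comp_def, Lp.enorm_toLp] using this

section

variable {n : ℕ} (hn : n % 4 = 2 ∨ n % 4 = 3)

include hn

theorem cftInt_sub {f g : E n → Cl n} (hf : Integrable f) (hg : Integrable g) :
    cftInt (f - g) = cftInt f - cftInt g := by
  ext1 ω
  simp only [cftInt, Pi.sub_apply, sub_mul]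
  exact integral_sub (integrable_mul_exp hn hf ω) (integrable_mul_exp hn hg ω)

/-! ### The Clifford Fourier transform on `L²` -/

theorem eLpNorm_cftInt_sub {f g : E n → Cl n} (hf : Integrable f) (hf' : MemLp f 2)
    (hg : Integrable g) (hg' : MemLp g 2) :
    eLpNorm (cftInt f - cftInt g) 2 volume = plancherelConst n * eLpNorm (f - g) 2 volume := by
  rw [← cftInt_sub hn hf hg, (memLp_cftInt hn (hf.sub hg) (hf'.sub hg')).2]

/-- The Clifford Fourier transform may be computed along any approximation by integrable
functions. -/
theorem isCFT_of_tendsto {ι : Type*} {l : Filter ι} [l.NeBot] {f F : E n → Cl n}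
    {φ : ι → E n → Cl n} (hf : MemLp f 2) (hF : MemLp F 2) (h₁ : ∀ k, Integrable (φ k))
    (h₂ : ∀ k, MemLp (φ k) 2)
    (hφ : Tendsto (fun k => eLpNorm (f - φ k) 2 volume) l (𝓝 0))
    (hφF : Tendsto (fun k => eLpNorm (F - cftInt (φ k)) 2 volume) l (𝓝 0)) : IsCFT f F := by
  refine isCFT_of_tendsto_cftInt hF ?_
  have hK := plancherelConst_ne_top n
  -- Compare the truncation with `φ k` by Plancherel and let `k` go to the limit: only the distance
  -- from `f` to its truncation survives.
  have bound : ∀ R : ℝ, eLpNorm (F - cftInt ((Metric.ball (0 : E n) R).indicator f)) 2 volume ≤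
      plancherelConst n * eLpNorm (f - (Metric.ball (0 : E n) R).indicator f) 2 volume := by
    intro R
    set g := (Metric.ball (0 : E n) R).indicator f
    have hg₁ : Integrable g := integrable_indicator_ball hf R
    have hg₂ : MemLp g 2 := memLp_indicator_ball hf R
    have ht : Tendsto (fun k => eLpNorm (F - cftInt (φ k)) 2 volume +
        plancherelConst n * (eLpNorm (f - φ k) 2 volume + eLpNorm (f - g) 2 volume)) l
        (𝓝 (0 + plancherelConst n * (0 + eLpNorm (f - g) 2 volume))) :=
      hφF.add (ENNReal.Tendsto.const_mul (hφ.add tendsto_const_nhds) (Or.inr hK))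
    rw [zero_add, zero_add] at ht
    refine ge_of_tendsto' ht fun k => ?_
    have e₁ : F - cftInt g = (F - cftInt (φ k)) + (cftInt (φ k) - cftInt g) := by abel
    have e₂ : φ k - g = -(f - φ k) + (f - g) := by abel
    have c₁ := memLp_cftInt hn (h₁ k) (h₂ k)
    have c₂ := memLp_cftInt hn hg₁ hg₂
    calc eLpNorm (F - cftInt g) 2 volume
        ≤ eLpNorm (F - cftInt (φ k)) 2 volume + eLpNorm (cftInt (φ k) - cftInt g) 2 volume := by
          rw [e₁]
          exact eLpNorm_add_le (hF.sub c₁.1).1 (c₁.1.sub c₂.1).1 (by norm_num)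
      _ ≤ _ := by
          rw [eLpNorm_cftInt_sub hn (h₁ k) (h₂ k) hg₁ hg₂, e₂]
          gcongr
          refine (eLpNorm_add_le (hf.sub (h₂ k)).neg.1 (hf.sub hg₂).1 (by norm_num)).trans ?_
          rw [eLpNorm_neg]
  refine tendsto_of_tendsto_of_tendsto_of_le_of_le tendsto_const_nhds ?_ (fun _ => zero_le) bound
  simpa using ENNReal.Tendsto.const_mul (tendsto_eLpNorm_sub_indicator_ball hf) (Or.inr hK)

theorem isCFT_cftInt {f : E n → Cl n} (h₁ : Integrable f) (h₂ : MemLp f 2) :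
    IsCFT f (cftInt f) :=
  isCFT_of_tendsto hn (l := (⊤ : Filter Unit)) (φ := fun _ => f) h₂ (memLp_cftInt hn h₁ h₂).1
    (fun _ => h₁) (fun _ => h₂) (by simp) (by simp)

/-- By Plancherel the transforms of the truncations form a Cauchy family in the complete space `L²`.
-/
theorem exists_isCFT {f : E n → Cl n} (hf : MemLp f 2) : ∃ F, IsCFT f F := by
  set φ : ℝ → E n → Cl n := fun R => (Metric.ball (0 : E n) R).indicator f
  have h₁ : ∀ R, Integrable (φ R) := integrable_indicator_ball hf
  have h₂ : ∀ R, MemLp (φ R) 2 := memLp_indicator_ball hf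
  have hc : ∀ R, MemLp (cftInt (φ R)) 2 := fun R => (memLp_cftInt hn (h₁ R) (h₂ R)).1
  have hφ : Tendsto (fun R => (h₂ R).toLp (φ R)) atTop (𝓝 (hf.toLp f)) := by
    refine (Lp.tendsto_Lp_iff_tendsto_eLpNorm'' φ h₂ f hf).2 ?_
    simpa only [eLpNorm_sub_comm] using tendsto_eLpNorm_sub_indicator_ball hf
  have hcau : CauchySeq fun R => (hc R).toLp (cftInt (φ R)) := by
    have h := hφ.cauchySeq
    rw [EMetric.cauchySeq_iff] at h ⊢
    intro ε hε
    obtain ⟨N, hN⟩ := h (ε / plancherelConst n)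
      (ENNReal.div_pos hε.ne' (plancherelConst_ne_top n))
    refine ⟨N, fun R hR S hS => ?_⟩
    have h' := hN R hR S hS
    rw [Lp.edist_toLp_toLp] at h' ⊢
    rw [eLpNorm_cftInt_sub hn (h₁ R) (h₂ R) (h₁ S) (h₂ S), mul_comm]
    exact ENNReal.mul_lt_of_lt_div h'
  obtain ⟨F, hF⟩ := cauchySeq_tendsto_of_complete hcau
  refine ⟨F, isCFT_of_tendsto_cftInt (Lp.memLp F) ?_⟩
  rw [← Lp.toLp_coeFn F (Lp.memLp F), Lp.tendsto_Lp_iff_tendsto_eLpNorm''] at hF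
  simpa only [eLpNorm_sub_comm] using hF

theorem IsCFT.eLpNorm_eq {f F : E n → Cl n} (hf : MemLp f 2) (h : IsCFT f F) :
    eLpNorm F 2 volume = plancherelConst n * eLpNorm f 2 volume := by
  have hc := fun R => memLp_cftInt hn (integrable_indicator_ball hf R) (memLp_indicator_ball hf R)
  have t₁ := tendsto_eLpNorm_of_tendsto_eLpNorm_sub h.memLp (fun R => (hc R).1) h.tendsto_cftInt
  have t₂ := ENNReal.Tendsto.const_mul (a := plancherelConst n)
    (tendsto_eLpNorm_of_tendsto_eLpNorm_sub hf (memLp_indicator_ball hf)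
    (tendsto_eLpNorm_sub_indicator_ball hf)) (Or.inr (plancherelConst_ne_top n))
  simp_rw [fun R => (hc R).2] at t₁
  exact tendsto_nhds_unique t₁ t₂

theorem IsCFT.sub {f F g G : E n → Cl n} (hf : MemLp f 2) (hg : MemLp g 2) (h : IsCFT f F)
    (h' : IsCFT g G) : IsCFT (f - g) (F - G) := by
  refine isCFT_of_tendsto_cftInt (h.memLp.sub h'.memLp) ?_
  refine tendsto_of_tendsto_of_tendsto_of_le_of_le tendsto_const_nhds
    (by simpa using h.tendsto_cftInt.add h'.tendsto_cftInt) (fun _ => zero_le) fun R => ?_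
  have c₁ := memLp_cftInt hn (integrable_indicator_ball hf R) (memLp_indicator_ball hf R)
  have c₂ := memLp_cftInt hn (integrable_indicator_ball hg R) (memLp_indicator_ball hg R)
  dsimp only
  rw [Set.indicator_sub', cftInt_sub hn (integrable_indicator_ball hf R)
    (integrable_indicator_ball hg R), sub_sub_sub_comm]
  exact eLpNorm_sub_le (h.memLp.sub c₁.1).1 (h'.memLp.sub c₂.1).1 (by norm_num)

/-- Linear maps of `Cl_n` that commute with right multiplication by `e^{i_n t}` commute with the
Clifford Fourier transform. -/
theorem IsCFT.map {f F : E n → Cl n} (hf : MemLp f 2) (h : IsCFT f F) (L : Cl n →L[ℝ] Cl n)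
    (hL : ∀ (M : Cl n) (t : ℝ), L (M * NormedSpace.exp (t • pseudoscalar n)) =
      L M * NormedSpace.exp (t • pseudoscalar n)) :
    IsCFT (fun x => L (f x)) (fun x => L (F x)) := by
  refine isCFT_of_tendsto_cftInt (L.comp_memLp' h.memLp) ?_
  have ht : Tendsto (fun R : ℝ => ENNReal.ofReal ‖L‖ *
      eLpNorm (F - cftInt ((Metric.ball (0 : E n) R).indicator f)) 2 volume) atTop (𝓝 0) := by
    simpa using ENNReal.Tendsto.const_mul (a := ENNReal.ofReal ‖L‖) h.tendsto_cftInt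
      (Or.inr ENNReal.ofReal_ne_top)
  refine tendsto_of_tendsto_of_tendsto_of_le_of_le tendsto_const_nhds ht (fun _ => zero_le)
    fun R => ?_
  have e : cftInt ((Metric.ball (0 : E n) R).indicator fun x => L (f x)) =
      fun ω => L (cftInt ((Metric.ball (0 : E n) R).indicator f) ω) := by
    ext1 ω
    rw [cftInt, cftInt, ← L.integral_comp_comm
      (integrable_mul_exp hn (integrable_indicator_ball hf R) ω)]
    refine integral_congr_ae (ae_of_all _ fun x => ?_)
    dsimp only
    rw [hL]
    by_cases hx : x ∈ Metric.ball (0 : E n) R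
    · simp only [Set.indicator_of_mem hx]
    · simp only [Set.indicator_of_notMem hx, map_zero]
  dsimp only
  rw [e]
  refine eLpNorm_le_mul_eLpNorm_of_ae_le_mul (ae_of_all _ fun ω => ?_) 2
  simp only [Pi.sub_apply, ← map_sub]
  exact L.le_opNorm _

theorem IsCFT.add {f F g G : E n → Cl n} (hf : MemLp f 2) (hg : MemLp g 2) (h : IsCFT f F)
    (h' : IsCFT g G) : IsCFT (f + g) (F + G) := by
  -- Negation commutes with the kernel, so sums reduce to differences.
  have hneg := h'.map hn hg (-ContinuousLinearMap.id ℝ (Cl n)) (by simp)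
  have := h.sub hn hf hg.neg hneg
  simpa [sub_eq_add_neg, Pi.neg_def, Pi.add_def] using this

theorem IsCFT.const_mul {f F : E n → Cl n} (hf : MemLp f 2) (h : IsCFT f F) (M : Cl n) :
    IsCFT (fun x => M * f x) (fun x => M * F x) :=
  h.map hn hf (mulL n M) fun N t => by simp only [mulL_apply, mul_assoc]

end

/-! ### Products of `L²` functions and Parseval's identity. -/

theorem MemLp.const_cliffMul {n : ℕ} {X : Type*} [MeasurableSpace X] {μ : Measure X}
    {f : X → Cl n} {p : ENNReal} (hf : MemLp f p μ) (M : Cl n) : MemLp (fun x => M * f x) p μ :=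
  (mulL n M).comp_memLp' hf

theorem MemLp.cliffMul_const {n : ℕ} {X : Type*} [MeasurableSpace X] {μ : Measure X}
    {f : X → Cl n} {p : ENNReal} (hf : MemLp f p μ) (M : Cl n) : MemLp (fun x => f x * M) p μ :=
  ((mulL n).flip M).comp_memLp' hf

theorem MemLp.cliffRev {n : ℕ} {X : Type*} [MeasurableSpace X] {μ : Measure X}
    {f : X → Cl n} {p : ENNReal} (hf : MemLp f p μ) : MemLp (fun x => rev (f x)) p μ :=
  (revL n).comp_memLp' hf

theorem integrable_mul_of_memLp_two {n : ℕ} {X : Type*} [MeasurableSpace X] {μ : Measure X}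
    {f g : X → Cl n} (hf : MemLp f 2 μ) (hg : MemLp g 2 μ) : Integrable (fun x => f x * g x) μ := by
  have h : Integrable (fun x => ‖mulL n‖ * (‖f x‖ * ‖g x‖)) μ :=
    (hf.norm.integrable_mul hg.norm).const_mul _
  refine h.mono' (hf.1.mul hg.1) (ae_of_all _ fun x => ?_)
  rw [← mul_assoc]
  exact norm_mul_le_mulL _ _

theorem integral_norm_sq_eq {n : ℕ} {X : Type*} [MeasurableSpace X] {μ : Measure X}
    {f : X → Cl n} (hf : MemLp f 2 μ) : ∫ x, ‖f x‖ ^ 2 ∂μ = (eLpNorm f 2 μ ^ 2).toReal := by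
  rw [hf.eLpNorm_eq_integral_rpow_norm (by norm_num) (by norm_num),
    ← ENNReal.ofReal_pow (by positivity),
    ENNReal.toReal_ofReal (by positivity), ← Real.rpow_natCast, ← Real.rpow_mul (by positivity)]
  simp

theorem norm_add_sq_sub_norm_sub_sq {n : ℕ} (M N : Cl n) :
    ‖M + N‖ ^ 2 - ‖M - N‖ ^ 2 = 4 * ∑ A, coordL A M * coordL A N := by
  rw [norm_sq_eq_sum_coordL, norm_sq_eq_sum_coordL, ← Finset.sum_sub_distrib, Finset.mul_sum]
  refine Finset.sum_congr rfl fun A _ => ?_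
  rw [map_add, map_sub]
  ring

theorem four_mul_integral_sum_coordL {n : ℕ} {f g : E n → Cl n} (hf : MemLp f 2) (hg : MemLp g 2) :
    4 * ∫ x, ∑ A, coordL A (f x) * coordL A (g x) =
      (eLpNorm (f + g) 2 volume ^ 2).toReal - (eLpNorm (f - g) 2 volume ^ 2).toReal := by
  rw [← integral_norm_sq_eq (hf.add hg), ← integral_norm_sq_eq (hf.sub hg),
    ← integral_sub ((hf.add hg).integrable_norm_pow (by norm_num))
      ((hf.sub hg).integrable_norm_pow (by norm_num)), ← integral_const_mul]
  simp only [Pi.add_apply, Pi.sub_apply, norm_add_sq_sub_norm_sub_sq]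

/-- Parseval's identity for the Clifford Fourier transform. -/
theorem IsCFT.integral_mul_rev {n : ℕ} (hn : n % 4 = 2 ∨ n % 4 = 3) {f F g G : E n → Cl n}
    (hf : MemLp f 2) (hg : MemLp g 2) (h : IsCFT f F) (h' : IsCFT g G) :
    ∫ ω, F ω * rev (G ω) = ((2 * Real.pi) ^ n) • ∫ x, f x * rev (g x) := by
  refine ext_coordL fun A => ?_
  -- Coordinate `A` of `(f, g)` is the real inner product of `f` with `e_A g`, and left
  -- multiplication by `e_A` commutes with the transform. Polarizing the Plancherel norm identity
  -- therefore suffices.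
  have hAg := MemLp.const_cliffMul hg (blade A)
  have hAG := h'.const_mul hn hg (blade A)
  rw [map_smul, ← (coordL A).integral_comp_comm
    (integrable_mul_of_memLp_two h.memLp (MemLp.cliffRev h'.memLp)),
    ← (coordL A).integral_comp_comm (integrable_mul_of_memLp_two hf (MemLp.cliffRev hg))]
  simp_rw [coordL_mul_rev]
  have e₁ := four_mul_integral_sum_coordL h.memLp hAG.memLp
  have e₂ := four_mul_integral_sum_coordL hf hAg
  rw [(h.add hn hf hAg hAG).eLpNorm_eq hn (hf.add hAg),
    (h.sub hn hf hAg hAG).eLpNorm_eq hn (hf.sub hAg)] at e₁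
  simp only [mul_pow, plancherelConst_sq, ENNReal.toReal_mul] at e₁ e₂
  rw [ENNReal.toReal_ofReal (by positivity)] at e₁
  rw [smul_eq_mul]
  linear_combination e₁ / 4 - (2 * Real.pi) ^ n * e₂ / 4

/-! ### Rotations -/

theorem SO.coe_inv {n : ℕ} (r : SO n) :
    ((r⁻¹ : SO n) : Matrix (Fin n) (Fin n) ℝ) = (r : Matrix (Fin n) (Fin n) ℝ).transpose := rfl

theorem rot_mul {n : ℕ} (r s : SO n) (x : E n) : rot (r * s) x = rot r (rot s x) := by
  simp [rot, Matrix.toLpLin_apply]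

theorem rot_one {n : ℕ} (x : E n) : rot (1 : SO n) x = x := by
  simp [rot]

theorem inner_rot {n : ℕ} (r : SO n) (x y : E n) :
    inner ℝ (rot r x) y = inner ℝ x (rot r⁻¹ y) := by
  have h := Matrix.toEuclideanLin_conjTranspose_eq_adjoint (r : Matrix (Fin n) (Fin n) ℝ)
  rw [Matrix.conjTranspose_eq_transpose_of_trivial] at h
  rw [rot, rot, SO.coe_inv, h, LinearMap.adjoint_inner_right]

theorem rot_inv_rot {n : ℕ} (r : SO n) (x : E n) : rot r⁻¹ (rot r x) = x := by
  rw [← rot_mul, inv_mul_cancel, rot_one]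

theorem rot_rot_inv {n : ℕ} (r : SO n) (x : E n) : rot r (rot r⁻¹ x) = x := by
  rw [← rot_mul, mul_inv_cancel, rot_one]

theorem rot_smul {n : ℕ} (r : SO n) (c : ℝ) (x : E n) : rot r (c • x) = c • rot r x :=
  map_smul (Matrix.toEuclideanLin (r : Matrix (Fin n) (Fin n) ℝ)) c x

/-- A rotation as a linear isometry. -/
def rotEquiv {n : ℕ} (r : SO n) : E n ≃ₗᵢ[ℝ] E n where
  toFun := rot r
  map_add' := map_add (Matrix.toEuclideanLin (r : Matrix (Fin n) (Fin n) ℝ))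
  map_smul' := map_smul (Matrix.toEuclideanLin (r : Matrix (Fin n) (Fin n) ℝ))
  invFun := rot r⁻¹
  left_inv := rot_inv_rot r
  right_inv := rot_rot_inv r
  norm_map' x := by
    change ‖rot r x‖ = ‖x‖
    rw [← sq_eq_sq₀ (norm_nonneg _) (norm_nonneg _), ← real_inner_self_eq_norm_sq,
      ← real_inner_self_eq_norm_sq, inner_rot, rot_inv_rot]

theorem continuous_rot_inv {n : ℕ} : Continuous fun p : SO n × E n => rot p.1⁻¹ p.2 := by
  simp_rw [rot, SO.coe_inv, Matrix.toLpLin_apply]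
  refine (PiLp.continuous_toLp 2 _).comp ?_
  exact Continuous.matrix_mulVec (continuous_subtype_val.comp continuous_fst).matrix_transpose
    ((PiLp.continuous_ofLp 2 _).comp continuous_snd)

/-- `SO(n)` is closed with entries in `[-1, 1]`. Compactness makes every Haar measure finite, hence
s-finite as Fubini requires. -/
instance instCompactSpaceSO (n : ℕ) : CompactSpace (SO n) := by
  have hset : {M : Matrix (Fin n) (Fin n) ℝ | M ∈ Matrix.specialOrthogonalGroup (Fin n) ℝ} =
      {M | M * M.transpose = 1} ∩ {M | M.det = 1} := by
    ext M
    exact Matrix.mem_specialOrthogonalGroup_iff.trans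
      (and_congr (Matrix.mem_orthogonalGroup_iff _ _) Iff.rfl)
  have hclosed : IsClosed
      {M : Matrix (Fin n) (Fin n) ℝ | M ∈ Matrix.specialOrthogonalGroup (Fin n) ℝ} := by
    rw [hset]
    exact (isClosed_eq (continuous_id.matrix_mul continuous_id.matrix_transpose)
      continuous_const).inter (isClosed_eq continuous_id.matrix_det continuous_const)
  have hcomp : IsCompact (Set.univ.pi fun _ : Fin n => Set.univ.pi fun _ : Fin n =>
      Set.Icc (-1 : ℝ) 1) :=
    isCompact_univ_pi fun _ => isCompact_univ_pi fun _ => isCompact_Icc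
  refine isCompact_iff_compactSpace.1 (hcomp.of_isClosed_subset hclosed
    fun (M : Matrix (Fin n) (Fin n) ℝ) hM => ?_)
  replace hM : M ∈ {M : Matrix (Fin n) (Fin n) ℝ | M * M.transpose = 1} ∩ {M | M.det = 1} :=
    hset ▸ hM
  intro i _ j _
  have h : ∑ k, M i k * M i k = 1 := by
    have h₁ : (M * M.transpose : Matrix (Fin n) (Fin n) ℝ) i i = 1 := by
      rw [show M * M.transpose = 1 from hM.1, Matrix.one_apply_eq]
    exact h₁
  have h' : M i j * M i j ≤ 1 := by
    rw [← h]
    exact Finset.single_le_sum (f := fun k => M i k * M i k) (fun k _ => mul_self_nonneg _)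
      (Finset.mem_univ j)
  exact abs_le.1 (abs_le_one_iff_mul_self_le_one.2 h')

/-! ### Similarities -/

theorem measurePreserving_rot {n : ℕ} (r : SO n) : MeasurePreserving (rot r) :=
  (rotEquiv r).measurePreserving

theorem quasiMeasurePreserving_sim {n : ℕ} {s : ℝ} (hs : s ≠ 0) (r : SO n) (b : E n) :
    Measure.QuasiMeasurePreserving (fun x : E n => s • rot r (x - b)) :=
  (Measure.quasiMeasurePreserving_smul _ hs).comp
    ((measurePreserving_rot r).comp (measurePreserving_sub_right volume b)).quasiMeasurePreserving

theorem integral_comp_sim {n : ℕ} (s : ℝ) (r : SO n) (b : E n) (g : E n → Cl n) :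
    ∫ x, g (s • rot r (x - b)) = |(s ^ n)⁻¹| • ∫ x, g x := by
  rw [integral_sub_right_eq_self (fun x => g (s • rot r x)) b,
    (measurePreserving_rot r).integral_comp (rotEquiv r).toHomeomorph.measurableEmbedding
      (fun x => g (s • x)), Measure.integral_comp_smul]
  simp

theorem eLpNorm_comp_sim {n : ℕ} {s : ℝ} (hs : s ≠ 0) (r : SO n) (b : E n) (g : E n → Cl n) :
    eLpNorm (fun x => g (s • rot r (x - b))) 2 volume =
      ENNReal.ofReal (|s ^ n|⁻¹) ^ (1 / 2 : ℝ) * eLpNorm g 2 volume := by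
  have h : MeasurePreserving fun x : E n => rot r (x - b) :=
    (measurePreserving_rot r).comp (measurePreserving_sub_right volume b)
  have he : MeasurableEmbedding fun x : E n => rot r (x - b) :=
    (rotEquiv r).toHomeomorph.measurableEmbedding.comp
      (Homeomorph.subRight b).measurableEmbedding
  have := he.eLpNorm_map_measure (μ := volume) (g := fun x => g (s • x)) (p := 2)
  rw [h.map_eq, eLpNorm_comp_smul g hs] at this
  exact this.symm

theorem eLpNorm_comp_sim_factor_ne_top (x : ℝ) :
    ENNReal.ofReal x ^ (1 / 2 : ℝ) ≠ ⊤ :=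
  ENNReal.rpow_ne_top_of_nonneg (by norm_num) ENNReal.ofReal_ne_top

theorem memLp_comp_sim {n : ℕ} {s : ℝ} (hs : s ≠ 0) (r : SO n) (b : E n) {g : E n → Cl n}
    (hg : MemLp g 2) : MemLp (fun x => g (s • rot r (x - b))) 2 :=
  ⟨hg.1.comp_quasiMeasurePreserving (quasiMeasurePreserving_sim hs r b), by
    rw [eLpNorm_comp_sim hs]
    exact ENNReal.mul_lt_top (eLpNorm_comp_sim_factor_ne_top _).lt_top hg.2⟩

/-! ### Daughter wavelets -/

theorem daughter_eq {n : ℕ} (ψ : E n → Cl n) (p : (ℝ × SO n) × E n) :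
    daughter ψ p = fun x =>
      (1 / p.1.1 ^ ((n : ℝ) / 2)) • ψ ((1 / p.1.1) • rot p.1.2⁻¹ (x - p.2)) := by
  ext1 x
  rw [daughter, rot_smul]

theorem memLp_daughter {n : ℕ} {ψ : E n → Cl n} (hψ : MemLp ψ 2) {p : (ℝ × SO n) × E n}
    (hp : 0 < p.1.1) : MemLp (daughter ψ p) 2 := by
  rw [daughter_eq]
  exact (memLp_comp_sim (one_div_pos.2 hp).ne' _ _ hψ).const_smul (1 / p.1.1 ^ ((n : ℝ) / 2))

theorem daughter_congr_ae {n : ℕ} {ψ φ : E n → Cl n} (h : ψ =ᵐ[volume] φ)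
    {p : (ℝ × SO n) × E n} (hp : 0 < p.1.1) : daughter ψ p =ᵐ[volume] daughter φ p := by
  rw [daughter_eq, daughter_eq]
  filter_upwards [(quasiMeasurePreserving_sim (one_div_pos.2 hp).ne' p.1.2⁻¹ p.2).ae_eq_comp h]
    with x hx
  simp only [Function.comp_apply] at hx
  rw [hx]

section

variable {n : ℕ} (hn : n % 4 = 2 ∨ n % 4 = 3)

include hn

theorem exp_add_smul_pseudoscalar (s t : ℝ) :
    NormedSpace.exp ((s + t) • pseudoscalar n) =
      NormedSpace.exp (s • pseudoscalar n) * NormedSpace.exp (t • pseudoscalar n) := by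
  rw [exp_smul_pseudoscalar hn, exp_smul_pseudoscalar hn, exp_smul_pseudoscalar hn, ← map_mul,
    ← Complex.exp_add]
  congr 2
  push_cast
  ring

theorem cftInt_daughter {φ : E n → Cl n} (h₁ : Integrable φ) {a : ℝ} (ha : 0 < a) (r : SO n)
    (b ω : E n) :
    cftInt (daughter φ ((a, r), b)) ω = a ^ ((n : ℝ) / 2) •
      (cftInt φ (a • rot r⁻¹ ω) * NormedSpace.exp (-(inner ℝ ω b) • pseudoscalar n)) := by
  set c : ℝ := 1 / a ^ ((n : ℝ) / 2) with hc
  set D : Cl n := NormedSpace.exp (-(inner ℝ ω b) • pseudoscalar n) with hD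
  set g : E n → Cl n := fun y =>
    c • (φ y * NormedSpace.exp (-(inner ℝ (a • rot r⁻¹ ω) y) • pseudoscalar n) * D) with hg
  have e : ∀ x, daughter φ ((a, r), b) x * NormedSpace.exp (-(inner ℝ ω x) • pseudoscalar n) =
      g ((1 / a) • rot r⁻¹ (x - b)) := by
    intro x
    have hx : inner ℝ (a • rot r⁻¹ ω) ((1 / a) • rot r⁻¹ (x - b)) =
        inner ℝ ω x - inner ℝ ω b := by
      rw [inner_smul_left, inner_smul_right, inner_rot, inv_inv, rot_rot_inv, inner_sub_right]
      simp only [conj_trivial]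
      field_simp
    rw [daughter_eq, hg]
    simp only
    rw [hx, hD, mul_assoc, ← exp_add_smul_pseudoscalar hn, smul_mul_assoc]
    congr 5
    ring
  rw [cftInt, funext e, integral_comp_sim, hg, integral_smul, smul_smul]
  have hint := ((mulL n).flip D).integral_comp_comm (integrable_mul_exp hn h₁ (a • rot r⁻¹ ω))
  simp only [ContinuousLinearMap.flip_apply, mulL_apply] at hint
  rw [hint, ← cftInt]
  congr 1
  -- The normalization `a^{-n/2}` times the Jacobian `aⁿ` leaves `a^{n/2}`.
  rw [hc, one_div, inv_pow, inv_inv, abs_of_nonneg (by positivity), ← Real.rpow_natCast,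
    one_div, ← Real.rpow_neg ha.le, ← Real.rpow_add ha]
  congr 1
  ring

/-- The Clifford Fourier transform of a daughter wavelet. -/
theorem IsCFT.daughter {ψ F : E n → Cl n} (hψ : MemLp ψ 2) (h : IsCFT ψ F) {a : ℝ} (ha : 0 < a)
    (r : SO n) (b : E n) :
    IsCFT (daughter ψ ((a, r), b)) fun ω => a ^ ((n : ℝ) / 2) •
      (F (a • rot r⁻¹ ω) * NormedSpace.exp (-(inner ℝ ω b) • pseudoscalar n)) := by
  have ha' : 1 / a ≠ 0 := (one_div_pos.2 ha).ne'
  set φ : ℝ → E n → Cl n := fun R => (Metric.ball (0 : E n) R).indicator ψ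
  have h₁ : ∀ R, Integrable (φ R) := integrable_indicator_ball hψ
  have h₂ : ∀ R, MemLp (φ R) 2 := memLp_indicator_ball hψ
  have hexp : Continuous fun ω : E n => NormedSpace.exp (-(inner ℝ ω b) • pseudoscalar n) := by
    simp_rw [real_inner_comm]
    exact continuous_exp_inner hn b
  -- The map on the frequency side scales the `L²` norm by a finite constant, since the exponential
  -- does not change moduli.
  have hmod : ∀ G : E n → Cl n, eLpNorm (fun ω => a ^ ((n : ℝ) / 2) •
      (G (a • rot r⁻¹ ω) * NormedSpace.exp (-(inner ℝ ω b) • pseudoscalar n))) 2 volume =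
      ‖a ^ ((n : ℝ) / 2)‖ₑ * (ENNReal.ofReal (|a ^ n|⁻¹) ^ (1 / 2 : ℝ) * eLpNorm G 2 volume) := by
    intro G
    have := eLpNorm_comp_sim ha.ne' r⁻¹ 0 G
    simp only [sub_zero] at this
    rw [← this, ← eLpNorm_const_smul]
    refine eLpNorm_congr_norm_ae (ae_of_all _ fun ω => ?_)
    rw [Pi.smul_apply, norm_smul, norm_smul, norm_mul_exp hn]
  -- The daughters of the truncations of `ψ` serve as approximation: `cftInt_daughter` computes
  -- their transforms exactly, and both convergences follow from scaling of norms.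
  refine isCFT_of_tendsto hn (l := atTop) (φ := fun R => CliffordWavelet.daughter (φ R) ((a, r), b))
    (memLp_daughter hψ ha) ⟨?_, ?_⟩ (fun R => ?_) (fun R => memLp_daughter (h₂ R) ha) ?_ ?_
  · have hm := (memLp_comp_sim ha.ne' r⁻¹ 0 h.memLp).1
    simp only [sub_zero] at hm
    exact (hm.mul hexp.aestronglyMeasurable).const_smul (a ^ ((n : ℝ) / 2))
  · rw [hmod]
    exact ENNReal.mul_lt_top enorm_lt_top
      (ENNReal.mul_lt_top (eLpNorm_comp_sim_factor_ne_top _).lt_top h.memLp.2)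
  · rw [daughter_eq]
    refine Integrable.smul (1 / a ^ ((n : ℝ) / 2)) ?_
    have := (h₁ R).comp_smul (R := 1 / a) ha'
    exact ((((rotEquiv r⁻¹).toHomeomorph.measurableEmbedding).integrable_map_iff.1 (by
      exact (measurePreserving_rot r⁻¹).map_eq.symm ▸ this)).comp_sub_right b)
  · have ht : Tendsto (fun R => ‖1 / a ^ ((n : ℝ) / 2)‖ₑ *
        (ENNReal.ofReal (|(1 / a) ^ n|⁻¹) ^ (1 / 2 : ℝ) * eLpNorm (ψ - φ R) 2 volume)) atTop
        (𝓝 (‖1 / a ^ ((n : ℝ) / 2)‖ₑ *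
        (ENNReal.ofReal (|(1 / a) ^ n|⁻¹) ^ (1 / 2 : ℝ) * 0))) :=
      ENNReal.Tendsto.const_mul (ENNReal.Tendsto.const_mul (tendsto_eLpNorm_sub_indicator_ball hψ)
        (Or.inr (eLpNorm_comp_sim_factor_ne_top _))) (Or.inr enorm_ne_top)
    rw [mul_zero, mul_zero] at ht
    refine ht.congr fun R => ?_
    rw [← eLpNorm_comp_sim ha' r⁻¹ b, ← eLpNorm_const_smul, daughter_eq, daughter_eq]
    congr 1
    ext1 x
    simp [smul_sub]
  · have ht : Tendsto (fun R => ‖a ^ ((n : ℝ) / 2)‖ₑ *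
        (ENNReal.ofReal (|a ^ n|⁻¹) ^ (1 / 2 : ℝ) * eLpNorm (F - cftInt (φ R)) 2 volume)) atTop
        (𝓝 (‖a ^ ((n : ℝ) / 2)‖ₑ * (ENNReal.ofReal (|a ^ n|⁻¹) ^ (1 / 2 : ℝ) * 0))) :=
      ENNReal.Tendsto.const_mul (ENNReal.Tendsto.const_mul h.tendsto_cftInt
        (Or.inr (eLpNorm_comp_sim_factor_ne_top _))) (Or.inr enorm_ne_top)
    rw [mul_zero, mul_zero] at ht
    refine ht.congr fun R => ?_
    rw [← hmod]
    congr 1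
    ext1 ω
    simp only [Pi.sub_apply, cftInt_daughter hn (h₁ R) ha, sub_mul, smul_sub]

/-! ### Grade restrictions -/

theorem GradeRestricted.exists_sign {ψ : E n → Cl n} (h : GradeRestricted ψ) :
    ∃ ε : ℝ, (ε = 1 ∨ ε = -1) ∧
      ∀ᵐ x, pseudoscalar n * ψ x = ε • (ψ x * pseudoscalar n) := by
  rcases hn with h2 | h3
  · rcases h h2 with h' | h'
    · refine ⟨1, Or.inl rfl, h'.mono fun x hx => ?_⟩
      rw [pseudoscalar_mul_of_even (by omega), CliffordAlgebra.involute_eq_of_mem_even hx, one_smul]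
    · refine ⟨-1, Or.inr rfl, h'.mono fun x hx => ?_⟩
      rw [pseudoscalar_mul_of_even (by omega), CliffordAlgebra.involute_eq_of_mem_odd hx]
      simp
  · exact ⟨1, Or.inl rfl, ae_of_all _ fun x => by
      rw [pseudoscalar_mul_of_odd (by omega), one_smul]⟩

/-- The map `M ↦ i_n M - ε M i_n` commutes with the kernel and annihilates `ψ`. By Plancherel it
annihilates the transform. -/
theorem IsCFT.ae_pseudoscalar_mul {ψ F : E n → Cl n} (hψ : MemLp ψ 2) (h : IsCFT ψ F) {ε : ℝ}
    (hε : ∀ᵐ x, pseudoscalar n * ψ x = ε • (ψ x * pseudoscalar n)) :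
    ∀ᵐ ω, pseudoscalar n * F ω = ε • (F ω * pseudoscalar n) := by
  set L : Cl n →L[ℝ] Cl n := mulL n (pseudoscalar n) - ε • (mulL n).flip (pseudoscalar n)
  have hL : ∀ M, L M = pseudoscalar n * M - ε • (M * pseudoscalar n) := fun M => rfl
  have hcomm : ∀ t : ℝ, NormedSpace.exp (t • pseudoscalar n) * pseudoscalar n =
      pseudoscalar n * NormedSpace.exp (t • pseudoscalar n) := by
    intro t
    have hi : pseudoscalar n = complexHom hn Complex.I := by simp [complexHom_apply]
    rw [exp_smul_pseudoscalar hn, hi, ← map_mul, ← map_mul, mul_comm]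
  have hLF := h.map hn hψ L fun M t => by
    rw [hL, hL, sub_mul, smul_mul_assoc, mul_assoc, mul_assoc, mul_assoc, hcomm]
  have hLψ : MemLp (fun x => L (ψ x)) 2 := L.comp_memLp' hψ
  have e := hLF.eLpNorm_eq hn hLψ
  have e₀ : eLpNorm (fun x => L (ψ x)) 2 volume = 0 := by
    rw [eLpNorm_eq_zero_iff hLψ.1 (by norm_num)]
    filter_upwards [hε] with x hx
    simp [hL, hx]
  rw [e₀, mul_zero, eLpNorm_eq_zero_iff hLF.memLp.1 (by norm_num)] at e
  filter_upwards [e] with ω hω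
  exact sub_eq_zero.1 hω

end

theorem IsCFT.congr_right {n : ℕ} {f F G : E n → Cl n} (h : IsCFT f F) (hFG : F =ᵐ[volume] G) :
    IsCFT f G :=
  isCFT_of_tendsto_cftInt ((memLp_congr_ae hFG).1 h.memLp) (h.tendsto_cftInt.congr fun _ =>
    eLpNorm_congr_ae (hFG.sub (EventuallyEq.refl _ _)))

/-! ### Admissibility -/

instance instSFiniteDilRotMeasure (n : ℕ) (ν : Measure (SO n)) [SFinite ν] :
    SFinite (dilRotMeasure n ν) := by
  rw [dilRotMeasure]
  infer_instance

theorem ae_dilRotMeasure_pos {n : ℕ} (ν : Measure (SO n)) [SFinite ν] :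
    ∀ᵐ q ∂(dilRotMeasure n ν), 0 < q.1 := by
  have h : ∀ᵐ a ∂((volume.restrict (Set.Ioi (0 : ℝ))).withDensity
      fun a => ENNReal.ofReal (1 / a ^ (n + 1))), 0 < a :=
    (withDensity_absolutelyContinuous _ _).ae_le (ae_restrict_mem measurableSet_Ioi)
  exact Measure.quasiMeasurePreserving_fst.ae h

theorem continuous_snd_fst_prodMk_snd {n : ℕ} :
    Continuous fun z : (ℝ × SO n) × E n => (z.1.2, z.2) := by
  fun_prop

theorem continuous_smul_rot_inv {n : ℕ} :
    Continuous fun z : (ℝ × SO n) × E n => z.1.1 • rot z.1.2⁻¹ z.2 := by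
  have h := (continuous_rot_inv (n := n)).comp continuous_snd_fst_prodMk_snd
  simp only [Function.comp_def] at h
  have h' : Continuous fun z : (ℝ × SO n) × E n => z.1.1 := by fun_prop
  exact h'.smul h

/-- For fixed `a > 0` and `r` the map `ω ↦ a r⁻¹ω` is nonsingular; Fubini then exchanges the two
quantifiers. This lets the transform of `ψ` be altered on a null set inside the admissibility
integral. -/
theorem ae_ae_smul_rot_inv_notMem {n : ℕ} (ν : Measure (SO n)) [SFinite ν] {N : Set (E n)}
    (hN : MeasurableSet N) (h₀ : volume N = 0) :
    ∀ᵐ ω : E n, ∀ᵐ q ∂(dilRotMeasure n ν), q.1 • rot q.2⁻¹ ω ∉ N := by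
  have hmeas : MeasurableSet {z : (ℝ × SO n) × E n | z.1.1 • rot z.1.2⁻¹ z.2 ∉ N} :=
    continuous_smul_rot_inv.measurable hN.compl
  have key : ∀ᵐ q ∂(dilRotMeasure n ν), ∀ᵐ ω : E n, q.1 • rot q.2⁻¹ ω ∉ N := by
    filter_upwards [ae_dilRotMeasure_pos ν] with q hq
    have h := (quasiMeasurePreserving_sim hq.ne' q.2⁻¹ 0).ae (p := fun ω => ω ∉ N)
      (measure_eq_zero_iff_ae_notMem.1 h₀)
    simpa only [sub_zero] using h
  exact (Measure.ae_ae_comm hmeas).1 key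

/-- A well-behaved representative of the Clifford Fourier transform of an admissible wavelet. -/
theorem IsAdmissible.exists_stronglyMeasurable {n : ℕ} (hn : n % 4 = 2 ∨ n % 4 = 3)
    {ν : Measure (SO n)} [SFinite ν] {ψ : E n → Cl n} {C : Cl n} (h : IsAdmissible ν ψ C)
    (hg : GradeRestricted ψ) :
    ∃ (F : E n → Cl n) (ε : ℝ), StronglyMeasurable F ∧ IsCFT ψ F ∧ (ε = 1 ∨ ε = -1) ∧
      (∀ ω, pseudoscalar n * F ω = ε • (F ω * pseudoscalar n)) ∧
      ∀ᵐ ω : E n, Integrable (admissibilityIntegrand F ω) (dilRotMeasure n ν) ∧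
        ∫ q, admissibilityIntegrand F ω q ∂(dilRotMeasure n ν) = C := by
  obtain ⟨F₀, hF₀, hC⟩ := h.constant
  obtain ⟨ε, hε, hεψ⟩ := hg.exists_sign hn
  have hεF := hF₀.ae_pseudoscalar_mul hn h.memLp hεψ
  have hmk := hF₀.memLp.1.ae_eq_mk
  obtain ⟨N, hNsub, hNm, hN₀⟩ := exists_measurable_superset_of_null
    (ae_iff.1 (hεF.and hmk))
  have hoff : ∀ ω ∉ N, pseudoscalar n * F₀ ω = ε • (F₀ ω * pseudoscalar n) ∧
      F₀ ω = hF₀.memLp.1.mk F₀ ω := fun ω hω => by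
    by_contra hc
    exact hω (hNsub hc)
  -- On the exceptional set the value is `0`, for which the commutation rule is trivial, so the rule
  -- holds at every point.
  set F : E n → Cl n := Nᶜ.indicator (hF₀.memLp.1.mk F₀)
  have hFF₀ : ∀ ω ∉ N, F₀ ω = F ω := fun ω hω => by
    rw [(hoff ω hω).2]
    exact (Set.indicator_of_mem (s := Nᶜ) hω _).symm
  have hae : F₀ =ᵐ[volume] F := by
    filter_upwards [measure_eq_zero_iff_ae_notMem.1 hN₀] with ω hω using hFF₀ ω hω
  refine ⟨F, ε, hF₀.memLp.1.stronglyMeasurable_mk.indicator hNm.compl, hF₀.congr_right hae, hε,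
    fun ω => ?_, ?_⟩
  · by_cases hω : ω ∈ N
    · simp [F, hω]
    · rw [← hFF₀ ω hω]
      exact (hoff ω hω).1
  · filter_upwards [hC, ae_ae_smul_rot_inv_notMem ν hNm hN₀] with ω hω hωN
    have he : admissibilityIntegrand F₀ ω =ᵐ[dilRotMeasure n ν] admissibilityIntegrand F ω := by
      filter_upwards [hωN] with q hq
      rw [admissibilityIntegrand, admissibilityIntegrand, hFF₀ _ hq]
    exact ⟨hω.1.congr he, by rw [← integral_congr_ae he, hω.2]⟩

/-- Passing `M̃` and `M` each costs one factor `ε`, and `ε² = 1`. Hence `C_ψ` commutes with `i_n`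
even when `ψ` anticommutes with it. -/
theorem pseudoscalar_mul_rev_mul {n : ℕ} (hn : n % 4 = 2 ∨ n % 4 = 3) {M : Cl n} {ε : ℝ}
    (hε : ε = 1 ∨ ε = -1) (h : pseudoscalar n * M = ε • (M * pseudoscalar n)) :
    pseudoscalar n * (rev M * M) = rev M * M * pseudoscalar n := by
  have h' := congrArg rev h
  simp only [rev_mul, rev_smul, rev_pseudoscalar hn, mul_neg, neg_mul, smul_neg, neg_inj] at h'
  have hε2 : ε * ε = 1 := by rcases hε with rfl | rfl <;> norm_num
  have h'' : pseudoscalar n * rev M = ε • (rev M * pseudoscalar n) := by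
    rw [h', smul_smul, hε2, one_smul]
  rw [← mul_assoc, h'', smul_mul_assoc, mul_assoc, h, mul_smul_comm, smul_smul, hε2, one_smul,
    mul_assoc]

theorem commute_pseudoscalar_of_integral {n : ℕ} (hn : n % 4 = 2 ∨ n % 4 = 3) {ν : Measure (SO n)}
    {F : E n → Cl n} {ε : ℝ} (hε : ε = 1 ∨ ε = -1)
    (hF : ∀ ω, pseudoscalar n * F ω = ε • (F ω * pseudoscalar n)) {ω : E n}
    (hω : Integrable (admissibilityIntegrand F ω) (dilRotMeasure n ν)) :
    Commute (pseudoscalar n) (∫ q, admissibilityIntegrand F ω q ∂(dilRotMeasure n ν)) := by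
  have h₁ := (mulL n (pseudoscalar n)).integral_comp_comm hω
  have h₂ := ((mulL n).flip (pseudoscalar n)).integral_comp_comm hω
  simp only [ContinuousLinearMap.flip_apply, mulL_apply] at h₁ h₂
  rw [commute_iff_eq, ← h₁, ← h₂]
  congr 1 with q
  rw [admissibilityIntegrand, mul_smul_comm, smul_mul_assoc,
    pseudoscalar_mul_rev_mul hn hε (hF _)]

/-! ### The wavelet transform in the frequency domain -/

/-- The function `ω ↦ a^{n/2} G(ω) F(a r⁻¹ ω)~`, whose inverse Clifford Fourier transform is the
wavelet transform when `F` and `G` are the transforms of the wavelet and of the signal. -/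
def freqTransform {n : ℕ} (F G : E n → Cl n) (z : (ℝ × SO n) × E n) : Cl n :=
  z.1.1 ^ ((n : ℝ) / 2) • (G z.2 * rev (F (z.1.1 • rot z.1.2⁻¹ z.2)))

theorem integrable_freqTransform {n : ℕ} {F G : E n → Cl n} (hF : MemLp F 2) (hG : MemLp G 2)
    {q : ℝ × SO n} (hq : 0 < q.1) : Integrable fun ω => freqTransform F G (q, ω) := by
  have h := memLp_comp_sim hq.ne' q.2⁻¹ 0 hF
  simp only [sub_zero] at h
  exact (integrable_mul_of_memLp_two hG (MemLp.cliffRev h)).smul (q.1 ^ ((n : ℝ) / 2))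

/-- Parseval puts `e^{i_n ω·b}` between `f̂` and `ψ̂~`; moving it to the right changes `b` to `ε b`.
This is where the grade restriction is needed. -/
theorem waveletTransform_eq_cftInt {n : ℕ} (hn : n % 4 = 2 ∨ n % 4 = 3) {ψ f F G : E n → Cl n}
    (hψ : MemLp ψ 2) (hf : MemLp f 2) (hF : IsCFT ψ F) (hG : IsCFT f G) {ε : ℝ}
    (hε : ε = 1 ∨ ε = -1) (hFε : ∀ ω, pseudoscalar n * F ω = ε • (F ω * pseudoscalar n))
    {q : ℝ × SO n} (hq : 0 < q.1) (b : E n) :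
    waveletTransform ψ f (q, b) =
      ((2 * Real.pi) ^ n)⁻¹ • cftInt (fun ω => freqTransform F G (q, ω)) (-(ε • b)) := by
  have h := hG.integral_mul_rev hn hf (memLp_daughter hψ (p := (q, b)) hq)
    (hF.daughter hn hψ hq q.2 b)
  have hpi : ((2 * Real.pi) ^ n) ≠ 0 := by positivity
  rw [waveletTransform, eq_inv_smul_iff₀ hpi, ← h, cftInt]
  refine integral_congr_ae (ae_of_all _ fun ω => ?_)
  have hε2 : ε * ε = 1 := by rcases hε with rfl | rfl <;> norm_num
  -- The extra factor `ε` in the angle cancels the one that commutation produces, leaving `e^{-i_n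
  -- ω·b}` to the right of `F`.
  have hc := complexHom_mul hn (hFε (q.1 • rot q.2⁻¹ ω)) (ε * -(inner ℝ ω b)) hε
  rw [← mul_assoc, hε2, one_mul] at hc
  simp only [freqTransform, rev_smul, mul_smul_comm, smul_mul_assoc]
  rw [exp_smul_pseudoscalar hn, exp_smul_pseudoscalar hn, ← hc, rev_mul, rev_complexHom, mul_assoc,
    ← Complex.exp_conj]
  congr 5
  rw [inner_neg_left, real_inner_smul_left, real_inner_comm]
  simp

theorem aestronglyMeasurable_freqTransform {n : ℕ} (ν : Measure (SO n)) [SFinite ν]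
    {F G : E n → Cl n} (hF : StronglyMeasurable F) (hG : AEStronglyMeasurable G) :
    AEStronglyMeasurable (freqTransform F G) ((dilRotMeasure n ν).prod volume) := by
  have h₁ : Measurable fun z : (ℝ × SO n) × E n => z.1.1 ^ ((n : ℝ) / 2) :=
    (measurable_fst.comp measurable_fst).pow_const _
  have h₂ : StronglyMeasurable fun z : (ℝ × SO n) × E n => F (z.1.1 • rot z.1.2⁻¹ z.2) :=
    hF.comp_measurable continuous_smul_rot_inv.measurable
  exact h₁.aestronglyMeasurable.smul
    (hG.comp_snd.mul (continuous_rev.comp_stronglyMeasurable h₂).aestronglyMeasurable)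

theorem coordL_empty_admissibilityIntegrand {n : ℕ} (F : E n → Cl n) (ω : E n) (q : ℝ × SO n) :
    coordL ∅ (admissibilityIntegrand F ω q) = q.1 ^ n * ‖F (q.1 • rot q.2⁻¹ ω)‖ ^ 2 := by
  rw [admissibilityIntegrand, map_smul, coordL_empty_rev_mul_self, smul_eq_mul]

theorem rpow_half_mul_self {a : ℝ} (ha : 0 < a) (n : ℕ) :
    a ^ ((n : ℝ) / 2) * a ^ ((n : ℝ) / 2) = a ^ n := by
  rw [← Real.rpow_add ha, add_halves, Real.rpow_natCast]

theorem memLp_freqTransform {n : ℕ} (ν : Measure (SO n)) [SFinite ν]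
    {F G : E n → Cl n} {C : Cl n} (hF : StronglyMeasurable F) (hG : MemLp G 2)
    (hC : ∀ᵐ ω : E n, Integrable (admissibilityIntegrand F ω) (dilRotMeasure n ν) ∧
        ∫ q, admissibilityIntegrand F ω q ∂(dilRotMeasure n ν) = C) :
    MemLp (freqTransform F G) 2 ((dilRotMeasure n ν).prod volume) := by
  have hm := aestronglyMeasurable_freqTransform ν hF hG.1
  set B : (ℝ × SO n) × E n → ℝ := fun z =>
    ‖G z.2‖ ^ 2 * (z.1.1 ^ n * ‖F (z.1.1 • rot z.1.2⁻¹ z.2)‖ ^ 2) with hB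
  have hpos : ∀ᵐ z ∂((dilRotMeasure n ν).prod (volume : Measure (E n))), 0 < z.1.1 :=
    Measure.quasiMeasurePreserving_fst.ae (ae_dilRotMeasure_pos ν)
  have hBm : AEStronglyMeasurable B ((dilRotMeasure n ν).prod volume) := by
    have h₂ : StronglyMeasurable fun z : (ℝ × SO n) × E n => F (z.1.1 • rot z.1.2⁻¹ z.2) :=
      hF.comp_measurable continuous_smul_rot_inv.measurable
    have h₁ : Measurable fun z : (ℝ × SO n) × E n => z.1.1 ^ n :=
      (measurable_fst.comp measurable_fst).pow_const _
    exact (hG.1.norm.pow 2).comp_snd.mul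
      (h₁.aestronglyMeasurable.mul (h₂.norm.pow 2).aestronglyMeasurable)
  -- Integrating over `(a, θ)` first gives `|G(ω)|²` times the scalar part of `C`, which is
  -- integrable in `ω`.
  have hBi : Integrable B ((dilRotMeasure n ν).prod volume) := by
    rw [integrable_prod_iff' hBm]
    constructor
    · filter_upwards [hC] with ω hω
      have := (coordL ∅).integrable_comp hω.1
      simp only [coordL_empty_admissibilityIntegrand] at this
      exact this.const_mul (‖G ω‖ ^ 2)
    · have hG2 : Integrable fun ω => ‖G ω‖ ^ 2 * coordL ∅ C :=
        (hG.integrable_norm_pow (by norm_num)).mul_const _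
      refine hG2.congr ?_
      filter_upwards [hC] with ω hω
      rw [← hω.2, ← (coordL ∅).integral_comp_comm hω.1, ← integral_const_mul]
      refine integral_congr_ae ?_
      filter_upwards [ae_dilRotMeasure_pos ν] with q hq
      rw [coordL_empty_admissibilityIntegrand, Real.norm_of_nonneg (by positivity)]
  rw [memLp_two_iff_integrable_sq_norm hm]
  refine (hBi.const_mul (‖mulL n‖ ^ 2)).mono' (hm.norm.pow 2) ?_
  filter_upwards [hpos] with z hz
  rw [Real.norm_of_nonneg (by positivity), freqTransform, norm_smul,
    Real.norm_of_nonneg (by positivity), mul_pow, sq (z.1.1 ^ ((n : ℝ) / 2)),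
    rpow_half_mul_self hz, hB]
  have h := norm_mul_le_mulL (G z.2) (rev (F (z.1.1 • rot z.1.2⁻¹ z.2)))
  rw [norm_rev] at h
  calc z.1.1 ^ n * ‖G z.2 * rev (F (z.1.1 • rot z.1.2⁻¹ z.2))‖ ^ 2
      ≤ z.1.1 ^ n * (‖mulL n‖ * ‖G z.2‖ * ‖F (z.1.1 • rot z.1.2⁻¹ z.2)‖) ^ 2 := by gcongr
    _ = _ := by ring

/-! ### Plancherel in the translation variable and the orthogonality relation. -/

theorem MemLp.ae_memLp_prodMk_left {n : ℕ} {X Y : Type*} [MeasurableSpace X] [MeasurableSpace Y]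
    {μ : Measure X} {ν : Measure Y} [SFinite μ] [SFinite ν] {H : X × Y → Cl n}
    (hH : MemLp H 2 (μ.prod ν)) : ∀ᵐ x ∂μ, MemLp (fun y => H (x, y)) 2 ν := by
  have h := (memLp_two_iff_integrable_sq_norm hH.1).1 hH
  filter_upwards [hH.1.prodMk_left, h.prod_right_ae] with x h₁ h₂
  exact (memLp_two_iff_integrable_sq_norm h₁).2 h₂

theorem integral_comp_neg_sign_smul {n : ℕ} {X : Type*} [NormedAddCommGroup X] [NormedSpace ℝ X]
    {ε : ℝ} (hε : ε = 1 ∨ ε = -1) (g : E n → X) : ∫ b, g (-(ε • b)) = ∫ b, g b := by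
  rcases hε with rfl | rfl
  · simpa using integral_neg_eq_self g volume
  · simp

theorem memLp_comp_neg_sign_smul {n : ℕ} {ε : ℝ} (hε : ε = 1 ∨ ε = -1) {g : E n → Cl n}
    (hg : MemLp g 2) : MemLp (fun b => g (-(ε • b))) 2 := by
  rcases hε with rfl | rfl
  · simpa [Function.comp_def] using
      hg.comp_measurePreserving (Measure.measurePreserving_neg (volume : Measure (E n)))
  · simpa using hg

/-- Plancherel's theorem for the wavelet transform at a fixed dilation and rotation. -/
theorem integral_waveletTransform_mul_rev {n : ℕ} (hn : n % 4 = 2 ∨ n % 4 = 3)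
    {ψ f h F G H : E n → Cl n} (hψ : MemLp ψ 2) (hf : MemLp f 2) (hh : MemLp h 2)
    (hF : IsCFT ψ F) (hG : IsCFT f G) (hH : IsCFT h H) {ε : ℝ}
    (hε : ε = 1 ∨ ε = -1) (hFε : ∀ ω, pseudoscalar n * F ω = ε • (F ω * pseudoscalar n))
    {q : ℝ × SO n} (hq : 0 < q.1) (hWf : MemLp (fun ω => freqTransform F G (q, ω)) 2)
    (hWh : MemLp (fun ω => freqTransform F H (q, ω)) 2) :
    ∫ b, waveletTransform ψ f (q, b) * rev (waveletTransform ψ h (q, b)) =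
      ((2 * Real.pi) ^ n)⁻¹ • ∫ ω, freqTransform F G (q, ω) * rev (freqTransform F H (q, ω)) := by
  have i₁ := integrable_freqTransform hF.memLp hG.memLp hq
  have i₂ := integrable_freqTransform hF.memLp hH.memLp hq
  have hP := (isCFT_cftInt hn i₁ hWf).integral_mul_rev hn hWf hWh (isCFT_cftInt hn i₂ hWh)
  have hpi : ((2 * Real.pi) ^ n) ≠ 0 := by positivity
  simp_rw [waveletTransform_eq_cftInt hn hψ hf hF hG hε hFε hq,
    waveletTransform_eq_cftInt hn hψ hh hF hH hε hFε hq, rev_smul, smul_mul_smul_comm]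
  rw [integral_smul, integral_comp_neg_sign_smul hε (fun b =>
    cftInt (fun ω => freqTransform F G (q, ω)) b *
      rev (cftInt (fun ω => freqTransform F H (q, ω)) b)), hP, smul_smul]
  congr 1
  field_simp

theorem memLp_waveletTransform_fiber {n : ℕ} (hn : n % 4 = 2 ∨ n % 4 = 3)
    {ψ f F G : E n → Cl n} (hψ : MemLp ψ 2) (hf : MemLp f 2)
    (hF : IsCFT ψ F) (hG : IsCFT f G) {ε : ℝ}
    (hε : ε = 1 ∨ ε = -1) (hFε : ∀ ω, pseudoscalar n * F ω = ε • (F ω * pseudoscalar n))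
    {q : ℝ × SO n} (hq : 0 < q.1) (hWf : MemLp (fun ω => freqTransform F G (q, ω)) 2) :
    MemLp (fun b => waveletTransform ψ f (q, b)) 2 := by
  simp_rw [waveletTransform_eq_cftInt hn hψ hf hF hG hε hFε hq]
  exact (memLp_comp_neg_sign_smul hε (memLp_cftInt hn
    (integrable_freqTransform hF.memLp hG.memLp hq) hWf).1).const_smul (((2 * Real.pi) ^ n)⁻¹)

theorem ae_simMeasure_pos {n : ℕ} (ν : Measure (SO n)) [SFinite ν] :
    ∀ᵐ p ∂(simMeasure n ν), 0 < p.1.1 :=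
  Measure.quasiMeasurePreserving_fst.ae (ae_dilRotMeasure_pos ν)

/-- For `a > 0`, replacing `ψ` and `f` by strongly measurable representatives leaves the transform
unchanged; joint measurability then follows from that of parameter integrals. -/
theorem aestronglyMeasurable_waveletTransform {n : ℕ} (ν : Measure (SO n)) [SFinite ν]
    {ψ f : E n → Cl n} (hψ : AEStronglyMeasurable ψ) (hf : AEStronglyMeasurable f) :
    AEStronglyMeasurable (waveletTransform ψ f) (simMeasure n ν) := by
  have hσ : Measurable fun z : ((ℝ × SO n) × E n) × E n =>
      ((1 / z.1.1.1, z.1.1.2), z.2 - z.1.2) := by fun_prop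
  have hψσ : StronglyMeasurable fun z : ((ℝ × SO n) × E n) × E n =>
      hψ.mk ψ ((1 / z.1.1.1) • rot z.1.1.2⁻¹ (z.2 - z.1.2)) :=
    hψ.stronglyMeasurable_mk.comp_measurable (continuous_smul_rot_inv.measurable.comp hσ)
  have hc : Measurable fun z : ((ℝ × SO n) × E n) × E n => 1 / z.1.1.1 ^ ((n : ℝ) / 2) := by
    fun_prop
  have hd : StronglyMeasurable fun z : ((ℝ × SO n) × E n) × E n =>
      daughter (hψ.mk ψ) z.1 z.2 := by
    simp_rw [daughter_eq]
    exact hc.stronglyMeasurable.smul hψσ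
  have hT : StronglyMeasurable (waveletTransform (hψ.mk ψ) (hf.mk f)) :=
    ((hf.stronglyMeasurable_mk.comp_measurable measurable_snd).mul
      (continuous_rev.comp_stronglyMeasurable hd)).integral_prod_right'
  refine hT.aestronglyMeasurable.congr ?_
  filter_upwards [ae_simMeasure_pos ν] with p hp
  refine integral_congr_ae ?_
  filter_upwards [hf.ae_eq_mk, daughter_congr_ae hψ.ae_eq_mk hp] with x h₁ h₂
  rw [h₁, h₂]

theorem memLp_waveletTransform {n : ℕ} (hn : n % 4 = 2 ∨ n % 4 = 3) (ν : Measure (SO n)) [SFinite ν]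
    {ψ f F G : E n → Cl n} (hψ : MemLp ψ 2) (hf : MemLp f 2)
    (hF : IsCFT ψ F) (hG : IsCFT f G) {ε : ℝ}
    (hε : ε = 1 ∨ ε = -1) (hFε : ∀ ω, pseudoscalar n * F ω = ε • (F ω * pseudoscalar n))
    (hW : MemLp (freqTransform F G) 2 ((dilRotMeasure n ν).prod volume)) :
    MemLp (waveletTransform ψ f) 2 (simMeasure n ν) := by
  have hm := aestronglyMeasurable_waveletTransform ν hψ.1 hf.1
  rw [memLp_two_iff_integrable_sq_norm hm]
  rw [simMeasure] at hm ⊢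
  have hm2 := hm.norm.pow 2
  refine (integrable_prod_iff hm2).2 ⟨?_, ?_⟩
  · filter_upwards [ae_dilRotMeasure_pos ν, MemLp.ae_memLp_prodMk_left hW] with q hq hWq
    exact (memLp_waveletTransform_fiber hn hψ hf hF hG hε hFε hq hWq).integrable_norm_pow
      (by norm_num)
  · have hi := (((memLp_two_iff_integrable_sq_norm hW.1).1 hW).integral_prod_left).const_mul
      (((2 * Real.pi) ^ n)⁻¹)
    refine hi.congr ?_
    filter_upwards [ae_dilRotMeasure_pos ν, MemLp.ae_memLp_prodMk_left hW] with q hq hWq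
    have hT := memLp_waveletTransform_fiber hn hψ hf hF hG hε hFε hq hWq
    -- The scalar part of the fibrewise identity with `h = f` equates the squared `L²` norms in `b`
    -- and in `ω`, up to `(2π)^{-n}`.
    have h := congrArg (coordL ∅)
      (integral_waveletTransform_mul_rev hn hψ hf hf hF hG hG hε hFε hq hWq hWq)
    rw [map_smul, ← (coordL ∅).integral_comp_comm
      (integrable_mul_of_memLp_two hT (MemLp.cliffRev hT)), ← (coordL ∅).integral_comp_comm
      (integrable_mul_of_memLp_two hWq (MemLp.cliffRev hWq))] at h
    simp only [coordL_empty_mul_rev_self, smul_eq_mul] at h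
    simp only [Pi.pow_apply, norm_pow, norm_norm]
    exact h.symm

/-- The orthogonality relation for the wavelet transform. -/
theorem integral_simMeasure_waveletTransform {n : ℕ} (hn : n % 4 = 2 ∨ n % 4 = 3)
    (ν : Measure (SO n)) [SFinite ν] {ψ f h F G H : E n → Cl n} {C : Cl n} (hψ : MemLp ψ 2)
    (hf : MemLp f 2) (hh : MemLp h 2) (hFm : StronglyMeasurable F)
    (hF : IsCFT ψ F) (hG : IsCFT f G) (hH : IsCFT h H) {ε : ℝ}
    (hε : ε = 1 ∨ ε = -1) (hFε : ∀ ω, pseudoscalar n * F ω = ε • (F ω * pseudoscalar n))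
    (hC : ∀ᵐ ω : E n, Integrable (admissibilityIntegrand F ω) (dilRotMeasure n ν) ∧
        ∫ q, admissibilityIntegrand F ω q ∂(dilRotMeasure n ν) = C) :
    Integrable (fun p => waveletTransform ψ f p * rev (waveletTransform ψ h p)) (simMeasure n ν) ∧
    ∫ p, waveletTransform ψ f p * rev (waveletTransform ψ h p) ∂(simMeasure n ν) =
      ((2 * Real.pi) ^ n)⁻¹ • ∫ ω, G ω * C * rev (H ω) := by
  have hWf := memLp_freqTransform ν hFm hG.memLp hC
  have hWh := memLp_freqTransform ν hFm hH.memLp hC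
  have hint := integrable_mul_of_memLp_two
    (memLp_waveletTransform hn ν hψ hf hF hG hε hFε hWf)
    (MemLp.cliffRev (memLp_waveletTransform hn ν hψ hh hF hH hε hFε hWh))
  refine ⟨hint, ?_⟩
  have hWint := integrable_mul_of_memLp_two hWf (MemLp.cliffRev hWh)
  rw [simMeasure] at hint ⊢
  calc ∫ p, waveletTransform ψ f p * rev (waveletTransform ψ h p) ∂(dilRotMeasure n ν).prod volume
      = ∫ q, ((2 * Real.pi) ^ n)⁻¹ • (∫ ω, freqTransform F G (q, ω) *
          rev (freqTransform F H (q, ω))) ∂(dilRotMeasure n ν) := by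
        rw [integral_prod _ hint]
        refine integral_congr_ae ?_
        filter_upwards [ae_dilRotMeasure_pos ν, MemLp.ae_memLp_prodMk_left hWf,
          MemLp.ae_memLp_prodMk_left hWh] with q hq h₁ h₂
        exact integral_waveletTransform_mul_rev hn hψ hf hh hF hG hH hε hFε hq h₁ h₂
    _ = ((2 * Real.pi) ^ n)⁻¹ • ∫ ω, ∫ q, freqTransform F G (q, ω) *
          rev (freqTransform F H (q, ω)) ∂(dilRotMeasure n ν) := by
        rw [integral_smul, integral_integral_swap hWint]
    _ = _ := by
        congr 1
        refine integral_congr_ae ?_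
        filter_upwards [hC] with ω hω
        -- `G(ω)` and `H(ω)~` do not depend on `(a, θ)`, so they leave the inner integral on their
        -- own sides and `C` remains between them.
        have h₁ := ((mulL n).flip (rev (H ω))).integral_comp_comm
          ((mulL n (G ω)).integrable_comp hω.1)
        rw [(mulL n (G ω)).integral_comp_comm hω.1, hω.2] at h₁
        simp only [ContinuousLinearMap.flip_apply, mulL_apply] at h₁
        rw [← h₁]
        refine integral_congr_ae ?_
        filter_upwards [ae_dilRotMeasure_pos ν] with q hq
        simp only [freqTransform, admissibilityIntegrand, rev_smul, rev_mul, rev_rev,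
          mul_smul_comm, smul_mul_assoc, mul_assoc]
        rw [smul_smul, rpow_half_mul_self hq]

/-! ### Inversion -/

theorem cliffInner_mul_mul {n : ℕ} {φ g : E n → Cl n} (hφ : MemLp φ 2) (hg : MemLp g 2)
    (M D : Cl n) :
    cliffInner (fun x => M * φ x * D) g = M * rev (cliffInner (fun x => g x * rev D) φ) := by
  have i₁ := integrable_mul_of_memLp_two (MemLp.cliffMul_const hg (rev D)) (MemLp.cliffRev hφ)
  rw [cliffInner, cliffInner, ← revL_apply, ← (revL n).integral_comp_comm i₁, ← mulL_apply,
    ← (mulL n M).integral_comp_comm ((revL n).integrable_comp i₁)]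
  simp only [revL_apply, mulL_apply, rev_mul, rev_rev, mul_assoc]

theorem isWeakIntegral_waveletTransform {n : ℕ} (hn : n % 4 = 2 ∨ n % 4 = 3)
    (ν : Measure (SO n)) [SFinite ν] {ψ : E n → Cl n} {C : Cl n} (hψ : IsAdmissible ν ψ C)
    (hgrade : GradeRestricted ψ) {f : E n → Cl n} (hf : MemLp f 2 volume) :
    IsWeakIntegral (simMeasure n ν)
      (fun p x => waveletTransform ψ f p * daughter ψ p x * Ring.inverse C) f := by
  obtain ⟨F, ε, hFm, hF, hε, hFε, hC⟩ := hψ.exists_stronglyMeasurable hn hgrade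
  refine ⟨?_, fun g hg => ?_⟩
  · filter_upwards [ae_simMeasure_pos ν] with p hp
    exact MemLp.cliffMul_const (MemLp.const_cliffMul (memLp_daughter hψ.memLp hp) _) _
  obtain ⟨G, hG⟩ := exists_isCFT hn hf
  obtain ⟨K, hK⟩ := exists_isCFT hn hg
  -- By `cliffInner_mul_mul`, the right factor `C⁻¹` passes to `g` as its reverse, so orthogonality
  -- is applied to `f` and `g D`.
  set D : Cl n := rev (Ring.inverse C) with hD
  have hcomm : Commute (pseudoscalar n) C := by
    obtain ⟨ω, hω⟩ := hC.exists
    exact hω.2 ▸ commute_pseudoscalar_of_integral hn hε hFε hω.1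
  have hcommD : Commute (pseudoscalar n) D := by
    have h₁ : Commute (pseudoscalar n) (Ring.inverse C) := by
      obtain ⟨u, rfl⟩ := hψ.isUnit
      rw [Ring.inverse_unit]
      exact hcomm.units_inv_right
    have h₂ := congrArg rev h₁.eq
    simp only [rev_mul, rev_pseudoscalar hn, mul_neg, neg_mul, neg_inj] at h₂
    exact h₂.symm
  have hh : MemLp (fun x => g x * D) 2 := MemLp.cliffMul_const hg D
  -- Right multiplication by `D` commutes with the kernel only because `D` commutes with `i_n`.
  have hH : IsCFT (fun x => g x * D) fun ω => K ω * D :=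
    hK.map hn hg ((mulL n).flip D) fun M t => by
      simp only [ContinuousLinearMap.flip_apply, mulL_apply]
      have hc := complexHom_mul hn (M := D) (ε := 1) (by rw [one_smul]; exact hcommD.eq) t
        (Or.inl rfl)
      rw [exp_smul_pseudoscalar hn, mul_assoc, hc, one_mul, mul_assoc]
  have hmain := integral_simMeasure_waveletTransform hn ν hψ.memLp hf hh hFm hF hG hH hε hFε hC
  have hcongr : (fun p => cliffInner
      (fun x => waveletTransform ψ f p * daughter ψ p x * Ring.inverse C) g) =ᵐ[simMeasure n ν]
      fun p => waveletTransform ψ f p * rev (waveletTransform ψ (fun x => g x * D) p) := by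
    filter_upwards [ae_simMeasure_pos ν] with p hp
    exact cliffInner_mul_mul (memLp_daughter hψ.memLp hp) hg _ _
  refine ⟨hmain.1.congr hcongr.symm, ?_⟩
  rw [integral_congr_ae hcongr, hmain.2]
  have hpi : ((2 * Real.pi) ^ n) ≠ 0 := by positivity
  rw [inv_smul_eq_iff₀ hpi, cliffInner, ← hG.integral_mul_rev hn hf hg hK]
  -- The reverse of `K D` is `C⁻¹ K̃`, so `C C⁻¹` cancels in the middle.
  congr 1 with ω
  rw [rev_mul, hD, rev_rev, mul_assoc, ← mul_assoc C, Ring.mul_inverse_cancel C hψ.isUnit, one_mul]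

end CliffordWavelet

end

theorem mainTheorem2 (n : ℕ) (hn : n % 4 = 2 ∨ n % 4 = 3)
    (ν : Measure (SO n)) [ν.IsHaarMeasure]
    (ψ : E n → Cl n) (C : Cl n) (hψ : IsAdmissible ν ψ C) (hgrade : GradeRestricted ψ)
    (f : E n → Cl n) (hf : MemLp f 2 volume) :
    IsWeakIntegral (simMeasure n ν)
      (fun p x => waveletTransform ψ f p * daughter ψ p x * Ring.inverse C) f ∧
    IsWeakIntegral (simMeasure n ν)
      (fun p x => cliffInner f (daughter ψ p) * daughter ψ p x * Ring.inverse C) f := by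
  have h := isWeakIntegral_waveletTransform hn ν hψ hgrade hf
  -- The two forms agree by definition: `waveletTransform ψ f p` unfolds to `cliffInner f (daughter
  -- ψ p)`.
  exact ⟨h, h⟩
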